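/- Let $p$ be a prime number with $5<p<32$ and $p\neq 17$, and write $\mathbb Z_p=\mathbb Z/p\mathbb Z$ and $[a,b,c]=a-b+c$ for $a,b,c\in\mathbb Z_p$. **Dehn colorings.** Around a crossing of a knot diagram $D$, choose one of the four regions and call it $x_1$; let $x_2$ be the region adjacent to $x_1$ across the under-arc, $x_3$ the region adjacent to $x_1$ across the over-arc, and $x_4$ the opposite region. A *Dehn $p$-coloring* of $D$ is a map $C$ from the set of regions of $D$ to $\mathbb Z_p$ such that $C(x_1)+C(x_3)=C(x_2)+C(x_4)$ at every crossing. It is *trivial* if $C(x_1)=C(x_4)$ and $C(x_3)=C(x_2)$ at every crossing, and *nontrivial* otherwise. A knot $K$ is *Dehn $p$-colorable* if some diagram of $K$ has a nontrivial Dehn $p$-coloring; then $\mathrm{mincol}_p(K)$ denotes the minimum of $\#\,\mathrm{Im}\,C$ over all diagrams $D$ of $K$ and all nontrivial Dehn $p$-colorings $C$ of $D$. **The invariant.** Let $C_2^{\rm SLB}(\mathbb Z_p)$ be the quotient of the free abelian group on the pairs $((a,b),(a,c))$, $a,b,c\in\mathbb Z_p$, by the subgroup generated by all elements $$((a,b),(a,b)),\qquad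 ((a,b),(a,c))+((b,a),(b,[a,b,c])),\qquad ((a,b),(a,c))+((c,[a,b,c]),(c,a)).$$ The homomorphism $\theta_p:C_2^{\rm SLB}(\mathbb Z_p)\to\mathbb Z_p$ is given by $$\theta_p\big(((a,b),(a,c))\big)=(a-b)\,\frac{(a-b+2c)^p+(a+b)^p-2(a+c)^p}{p},$$ where the numerator is calculated in $\mathbb Z$ with integer representatives of $a,b,c$ and is divisible by $p$; the value in $\mathbb Z_p$ does not depend on the representatives. For a Dehn $p$-coloring $C$ of a diagram $D$, the weight of a crossing is $\varepsilon\,((a,b),(a,c))$ with $a=C(x_1)$, $b=C(x_2)$, $c=C(x_3)$, where $\varepsilon=+1$ if the normal vector from $x_1$ to $x_3$ followed by the normal vector from $x_1$ to $x_2$ is a right-handed basis of $\mathbb R^2$, and $\varepsilon=-1$ otherwise; in $C_2^{\rm SLB}(\mathbb Z_p)$ it does not depend on the choice of $x_1$. Let $W(D,C)\in C_2^{\rm SLB}(\mathbb Z_p)$ be the sum of the weights of all crossings, and let $$\Phi^{\rm NT}_{\theta_p}(K)=\{\theta_p(W(D,C)) \mid C \text{ a nontrivial Dehn } p\text{-coloring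 of } D\}$$ as a multiset, where $D$ is any diagram of $K$ (the multiset does not depend on which). **Theorem.** Let $K$ be a Dehn $p$-colorable knot. If $0\notin\Phi^{\rm NT}_{\theta_p}(K)$, then $$\mathrm{mincol}_p(K)\ \ge\ \lfloor\log_2 p\rfloor+3 .$$ -/

import Mathlib

/-! ### Knot diagrams

A diagram with `n` crossings has half-edges ("darts") `(v, k)`: at the crossing `v` the four darts are
listed counterclockwise as `(v, 0), (v, 1), (v, 2), (v, 3)`, where `0, 2` belong to the under-strand
and `1, 3` to the over-strand.  The corner `(v, k)` is the sector at `v` between the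
darts `(v, k)` and `(v, k + 1)`. -/

/-- Darts of a diagram with `n` crossings. -/
abbrev Dart (n : ℕ) : Type := Fin n × ZMod 4

/-- The dart (or corner) reached from `d` by `s` counterclockwise quarter turns about its crossing. -/
def Dart.rot {n : ℕ} (d : Dart n) (s : ZMod 4) : Dart n := (d.1, d.2 + s)

/-- The dart `d` belongs to the over-strand of its crossing. -/
def Dart.IsOver {n : ℕ} (d : Dart n) : Prop := d.2 = 1 ∨ d.2 = 3

instance {n : ℕ} (d : Dart n) : Decidable d.IsOver := by
  unfold Dart.IsOver
  infer_instance

/-- The quarter turn (by `s` steps) as a permutation of the darts. -/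
def Dart.rotPerm (n : ℕ) (s : ZMod 4) : Equiv.Perm (Dart n) :=
  Equiv.prodCongr (Equiv.refl _) (Equiv.addRight s)

/-- An unoriented knot diagram on the oriented sphere (with at least one crossing), up to
isotopy: `glue` joins the darts in pairs, the pairs being the semi-arcs.  (The only diagram without
crossings is the circle.  It has no nontrivial coloring, and all one-crossing diagrams of the unknot
are joined by Reidemeister moves that avoid it.) -/
structure KnotDiagram where
  /-- The number of crossings. -/
  n : ℕ
  /-- The other end of the semi-arc that starts with a given dart. -/
  glue : Equiv.Perm (Dart n)
  glue_glue : ∀ d, glue (glue d) = d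
  glue_ne : ∀ d, glue d ≠ d
  /-- There is one component: going along a semi-arc and straight on through the next crossing,
  again and again, one gets from every semi-arc to every other one (in one of its directions). -/
  one_component : ∀ d d' : Dart n,
    Equiv.Perm.SameCycle (glue.trans (Dart.rotPerm n 2)) d d' ∨
    Equiv.Perm.SameCycle (glue.trans (Dart.rotPerm n 2)) d (glue d')
  /-- The surface is a sphere: the number of faces is `n + 2` (Euler's formula for a
  connected graph with `n` vertices and `2 * n` edges). -/
  planar : Nat.card (Quotient
    (Equiv.Perm.SameCycle.setoid (glue.trans (Dart.rotPerm n (-1))))) = n + 2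

namespace KnotDiagram

/-- The next corner of the same region, along the semi-arc of the dart `d`: the corner `d` lies on the
left of that semi-arc (seen from `d`), and so does the corner just clockwise of the dart
at which the semi-arc arrives. -/
def face (D : KnotDiagram) : Equiv.Perm (Dart D.n) := D.glue.trans (Dart.rotPerm D.n (-1))

/-- The regions of the diagram: corners modulo going around the boundary of a region. -/
def Region (D : KnotDiagram) : Type := Quotient (Equiv.Perm.SameCycle.setoid D.face)

/-- The region that contains a corner. -/
def regionOf (D : KnotDiagram) (c : Dart D.n) : D.Region := Quotient.mk _ c

/-! ### Reidemeister moves -/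

/-- `D'` is the same diagram as `D` with its crossings renamed, and with the
darts at each crossing possibly renumbered by a half turn (which keeps under and over). -/
def Iso (D D' : KnotDiagram) : Prop :=
  ∃ (f : Fin D.n ≃ Fin D'.n) (s : Fin D.n → ZMod 4), (∀ v, s v = 0 ∨ s v = 2) ∧
    ∀ a b : Dart D.n, D.glue a = b →
      D'.glue (f a.1, a.2 + s a.1) = (f b.1, b.2 + s b.1)

/-- First move: `D'` arises from `D` by a kink, with a new crossing `x = f none`, in the semi-arc
that joins `d` and `D.glue d`.  The parity of `k` and the choice between `d` and `D.glue d` give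
the four kinds of kinks. -/
def R1 (D D' : KnotDiagram) : Prop :=
  ∃ (f : Option (Fin D.n) ≃ Fin D'.n) (d : Dart D.n) (k : ZMod 4),
    D'.glue (f none, k) = (f none, k + 1) ∧
    D'.glue (f none, k + 2) = (f (some d.1), d.2) ∧
    D'.glue (f none, k + 3) = (f (some (D.glue d).1), (D.glue d).2) ∧
    ∀ a : Dart D.n, a ≠ d → a ≠ D.glue d →
      D'.glue (f (some a.1), a.2) = (f (some (D.glue a).1), (D.glue a).2)

/-- Second move: two different semi-arcs, that of `a` and that of `b`, have the same region on their
left (seen from `a` and from `b`), and the former is pushed over the latter inside this region.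
This gives two new crossings `x = f (inr 0)` and `y = f (inr 1)`, which are met in the
order `x, y` from `a`, and in the order `y, x` from `b`. -/
def R2 (D D' : KnotDiagram) : Prop :=
  ∃ (f : Fin D.n ⊕ Fin 2 ≃ Fin D'.n) (a b : Dart D.n),
    D.regionOf a = D.regionOf b ∧ a ≠ b ∧ a ≠ D.glue b ∧
    D'.glue (f (Sum.inr 0), 3) = (f (Sum.inl a.1), a.2) ∧
    D'.glue (f (Sum.inr 0), 1) = (f (Sum.inr 1), 1) ∧
    D'.glue (f (Sum.inr 1), 3) = (f (Sum.inl (D.glue a).1), (D.glue a).2) ∧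
    D'.glue (f (Sum.inr 1), 0) = (f (Sum.inl b.1), b.2) ∧
    D'.glue (f (Sum.inr 1), 2) = (f (Sum.inr 0), 0) ∧
    D'.glue (f (Sum.inr 0), 2) = (f (Sum.inl (D.glue b).1), (D.glue b).2) ∧
    ∀ c : Dart D.n, c ≠ a → c ≠ D.glue a → c ≠ b → c ≠ D.glue b →
      D'.glue (f (Sum.inl c.1), c.2) = (f (Sum.inl (D.glue c).1), (D.glue c).2)

/-- `d` is one of the six darts that form the sides of the triangle with the corner `c` and the
next corners `D.face c` and `D.face (D.face c)`. -/
def IsSide (D : KnotDiagram) (c d : Dart D.n) : Prop :=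
  (d = c ∨ d = D.face c ∨ d = D.face (D.face c)) ∨
  (d = c.rot 1 ∨ d = (D.face c).rot 1 ∨ d = (D.face (D.face c)).rot 1)

open Classical in
/-- When every strand of a triangle is moved (in parallel) across the crossing of the two others,
it meets these two in the opposite order, in the same directions.  So, on a strand that runs
`P -> (far x) x (near x) -> (near y) y (far y) -> Q`, the dart `far x` changes places with `near y`,
and `near x` with `far y`. -/
noncomputable def triangleSwap (D : KnotDiagram) (c d : Dart D.n) : Dart D.n :=
  if D.IsSide c d then (D.glue d).rot 2
  else if D.IsSide c (d.rot 2) then D.glue (d.rot 2)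
  else d

/-- Third move: there is a triangular region with three different crossings, such that the strand
of its side that starts with the dart `c` passes over the two other strands, and this strand
is moved across the crossing of the two others. -/
def R3 (D D' : KnotDiagram) : Prop :=
  ∃ c : Dart D.n, D.face (D.face (D.face c)) = c ∧
    c.1 ≠ (D.face c).1 ∧ c.1 ≠ (D.face (D.face c)).1 ∧ (D.face c).1 ≠ (D.face (D.face c)).1 ∧
    c.IsOver ∧ (D.glue c).IsOver ∧
    ∃ f : Fin D.n ≃ Fin D'.n, ∀ a b : Dart D.n, D.glue a = b →
      D'.glue (f (D.triangleSwap c a).1, (D.triangleSwap c a).2) =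
        (f (D.triangleSwap c b).1, (D.triangleSwap c b).2)

/-- `D` and `D'` differ by a renaming or a Reidemeister move. -/
def Step (D D' : KnotDiagram) : Prop := Iso D D' ∨ R1 D D' ∨ R2 D D' ∨ R3 D D'

end KnotDiagram

/-- A knot: a class of diagrams for the equivalence relation generated by the Reidemeister moves. -/
def Knot : Type := Quot KnotDiagram.Step

/-- `D` is a diagram of the knot `K`. -/
def Knot.HasDiagram (K : Knot) (D : KnotDiagram) : Prop := Quot.mk KnotDiagram.Step D = K

namespace KnotDiagram

/-! ### Dehn colorings -/

/-- The corner next to `c` at the same crossing, on the other side of the over-strand. -/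
def overNbr {n : ℕ} (c : Dart n) : Dart n := if c.IsOver then c.rot (-1) else c.rot 1

/-- The corner next to `c` at the same crossing, on the other side of the under-strand. -/
def underNbr {n : ℕ} (c : Dart n) : Dart n := if c.IsOver then c.rot 1 else c.rot (-1)

/-- Dehn `p`-colorings.  Around a crossing, `x₁` is any corner `c`, `x₂` and `x₃` are next to it across
the under-strand and across the over-strand, and `x₄` is opposite to it; the condition is
`C x₁ + C x₃ = C x₂ + C x₄`. -/
def IsDehnColoring (D : KnotDiagram) (p : ℕ) (C : D.Region → ZMod p) : Prop :=
  ∀ c : Dart D.n, C (D.regionOf c) + C (D.regionOf (overNbr c)) =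
    C (D.regionOf (underNbr c)) + C (D.regionOf (c.rot 2))

/-- Every crossing is trivially colored: `C x₁ = C x₄` and `C x₃ = C x₂`. -/
def IsTrivialColoring (D : KnotDiagram) (p : ℕ) (C : D.Region → ZMod p) : Prop :=
  ∀ c : Dart D.n, C (D.regionOf c) = C (D.regionOf (c.rot 2)) ∧
    C (D.regionOf (overNbr c)) = C (D.regionOf (underNbr c))

/-- The set of nontrivial Dehn `p`-colorings. -/
def ColNT (D : KnotDiagram) (p : ℕ) : Set (D.Region → ZMod p) :=
  {C | D.IsDehnColoring p C ∧ ¬ D.IsTrivialColoring p C}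

end KnotDiagram

/-- `K` has a diagram with a nontrivial Dehn `p`-coloring. -/
def Knot.IsDehnColorable (K : Knot) (p : ℕ) : Prop :=
  ∃ D : KnotDiagram, K.HasDiagram D ∧ (D.ColNT p).Nonempty

/-- The minimum number of colors, over all nontrivially Dehn `p`-colored diagrams of `K`. -/
noncomputable def Knot.mincol (K : Knot) (p : ℕ) : ℕ :=
  sInf {m | ∃ D : KnotDiagram, K.HasDiagram D ∧ ∃ C ∈ D.ColNT p, m = (Set.range C).ncard}

/-! ### Symmetric local biquandle 2-chains of `ZMod p` -/

/-- The tribracket `[a, b, c]`. -/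
def tribracket {p : ℕ} (a b c : ZMod p) : ZMod p := a - b + c

/-- The free abelian group on the pairs `((a, b), (a, c))`, written as triples `(a, b, c)`. -/
abbrev C2lb (p : ℕ) : Type := FreeAbelianGroup (ZMod p × ZMod p × ZMod p)

/-- The generator `((a, b), (a, c))`. -/
def pairGen {p : ℕ} (a b c : ZMod p) : C2lb p := FreeAbelianGroup.of (a, b, c)

/-- The degenerate chains, generated by the elements `((a, b), (a, b))`. -/
def D2lb (p : ℕ) : AddSubgroup (C2lb p) :=
  AddSubgroup.closure {x | ∃ a b : ZMod p, x = pairGen a b b}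

/-- The chains to be killed by the involution `ρ (a, b) = (b, a)`.  With
`(a, b) ⊻ (a, c) = (c, [a, b, c])` and `(a, b) ⊼ (a, c) = (c, [a, c, b])` they are generated by
`((a, b), (a, c)) + (ρ (a, b), (a, c) ⊼ (a, b))` and
`((a, b), (a, c)) + ((a, b) ⊻ (a, c), ρ (a, c))`. -/
def D2rho (p : ℕ) : AddSubgroup (C2lb p) :=
  AddSubgroup.closure
    ({x | ∃ a b c : ZMod p, x = pairGen a b c + pairGen b a (tribracket a b c)} ∪
     {x | ∃ a b c : ZMod p, x = pairGen a b c + pairGen c (tribracket a b c) a})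

/-- The group of symmetric local biquandle 2-chains. -/
abbrev C2SLB (p : ℕ) : Type := C2lb p ⧸ (D2lb p ⊔ D2rho p)

namespace KnotDiagram

/-- The weight of the crossing of `c`, with the corner `c` as specified region.  At the corners
`(v, 0)` and `(v, 2)` the normals `(n_o, n_u)` are right-handed; at `(v, 1)` and `(v, 3)` they are not. -/
def weight (D : KnotDiagram) {p : ℕ} (C : D.Region → ZMod p) (c : Dart D.n) : C2SLB p :=
  let g : C2SLB p := QuotientAddGroup.mk
    (pairGen (C (D.regionOf c)) (C (D.regionOf (underNbr c))) (C (D.regionOf (overNbr c))))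
  if c.IsOver then -g else g

/-- The chain `W(D, C)`: the sum of the weights of all crossings, the corner `(v, 0)` being taken as
the specified region at `v`. -/
def W (D : KnotDiagram) {p : ℕ} (C : D.Region → ZMod p) : C2SLB p :=
  ∑ v : Fin D.n, D.weight C (v, 0)

/-- One quarter turn of the specified region does not change the weight. -/
theorem weight_rot_one (D : KnotDiagram) {p : ℕ} (C : D.Region → ZMod p)
    (hC : D.IsDehnColoring p C) (c : Dart D.n) : D.weight C (c.rot 1) = D.weight C c := by
  have key : ∀ a b c : ZMod p, (QuotientAddGroup.mk (pairGen a b c) : C2SLB p) =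
      -QuotientAddGroup.mk (pairGen b a (tribracket a b c)) := by
    intro a b c
    rw [eq_neg_iff_add_eq_zero, ← QuotientAddGroup.mk_add, QuotientAddGroup.eq_zero_iff]
    exact AddSubgroup.mem_sup_right (AddSubgroup.subset_closure (Or.inl ⟨a, b, c, rfl⟩))
  have key' : ∀ a b c : ZMod p, (QuotientAddGroup.mk (pairGen a b c) : C2SLB p) =
      -QuotientAddGroup.mk (pairGen c (tribracket a b c) a) := by
    intro a b c
    rw [eq_neg_iff_add_eq_zero, ← QuotientAddGroup.mk_add, QuotientAddGroup.eq_zero_iff]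
    exact AddSubgroup.mem_sup_right (AddSubgroup.subset_closure (Or.inr ⟨a, b, c, rfl⟩))
  obtain ⟨v, k⟩ := c
  have h := hC (v, k)
  by_cases hk : Dart.IsOver ((v, k) : Dart D.n)
  · have hk' : ¬ Dart.IsOver (Dart.rot ((v, k) : Dart D.n) 1) := by
      revert hk; simp only [Dart.IsOver, Dart.rot]; clear h; revert k; decide
    simp only [weight, overNbr, underNbr, hk, hk', if_true, if_false] at h ⊢
    have e1 : (Dart.rot ((v, k) : Dart D.n) 1).rot (-1) = (v, k) := by simp [Dart.rot]
    have e2 : (Dart.rot ((v, k) : Dart D.n) 1).rot 1 = Dart.rot (v, k) 2 := by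
      simp only [Dart.rot, Prod.mk.injEq, true_and, add_assoc]; congr 1
    rw [e1, e2, key (C (D.regionOf (v, k)))]
    simp only [tribracket, neg_neg]
    congr 3
    linear_combination -h
  · have hk' : Dart.IsOver (Dart.rot ((v, k) : Dart D.n) 1) := by
      revert hk; simp only [Dart.IsOver, Dart.rot]; clear h; revert k; decide
    simp only [weight, overNbr, underNbr, hk, hk', if_true, if_false] at h ⊢
    have e1 : (Dart.rot ((v, k) : Dart D.n) 1).rot (-1) = (v, k) := by simp [Dart.rot]
    have e2 : (Dart.rot ((v, k) : Dart D.n) 1).rot 1 = Dart.rot (v, k) 2 := by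
      simp only [Dart.rot, Prod.mk.injEq, true_and, add_assoc]; congr 1
    rw [e1, e2, key' (C (D.regionOf (v, k)))]
    simp only [tribracket]
    congr 3
    linear_combination -h

/-- The colorings of a diagram are finite in number. -/
theorem colNT_finite (D : KnotDiagram) (p : ℕ) [NeZero p] : (D.ColNT p).Finite := by
  have : Finite D.Region := Quotient.finite _
  exact Set.toFinite _

/-- The multiset of the values `θ (W(D, C))`, `C` running over the nontrivial Dehn `p`-colorings. -/
noncomputable def PhiNT (D : KnotDiagram) {p : ℕ} [NeZero p] {A : Type*} [AddCommGroup A]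
    (θ : C2SLB p →+ A) : Multiset A :=
  (D.colNT_finite p).toFinset.val.map fun C => θ (D.W C)

end KnotDiagram

/-! ### The cocycle -/

/-- The numerator, calculated in the integers. -/
def thetaNum (p : ℕ) (a b c : ℤ) : ℤ := (a - b + 2 * c) ^ p + (a + b) ^ p - 2 * (a + c) ^ p

/-- The value of `θ_p` at `((a, b), (a, c))`. -/
def thetaVal (p : ℕ) (a b c : ZMod p) : ZMod p :=
  (a - b) * ((thetaNum p a.val b.val c.val / p : ℤ) : ZMod p)

/-- The numerator is divisible by `p`. -/
theorem dvd_thetaNum (p : ℕ) [Fact p.Prime] (a b c : ℤ) : (p : ℤ) ∣ thetaNum p a b c := by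
  rw [← ZMod.intCast_zmod_eq_zero_iff_dvd]
  simp only [thetaNum]
  push_cast
  simp only [ZMod.pow_card]
  ring

theorem thetaNum_congr {p : ℕ} {a b c a' b' c' : ℤ} (ha : (p : ℤ) ∣ a - a')
    (hb : (p : ℤ) ∣ b - b') (hc : (p : ℤ) ∣ c - c') :
    (p : ℤ) ^ 2 ∣ thetaNum p a b c - thetaNum p a' b' c' := by
  have key : ∀ x y : ℤ, (p : ℤ) ∣ x - y → (p : ℤ) ^ 2 ∣ x ^ p - y ^ p := by
    intro x y h
    simpa using dvd_sub_pow_of_dvd_sub h 1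
  have h1 := key (a - b + 2 * c) (a' - b' + 2 * c') (by
    rw [show a - b + 2 * c - (a' - b' + 2 * c') = (a - a') - (b - b') + 2 * (c - c') by ring]
    exact dvd_add (dvd_sub ha hb) (dvd_mul_of_dvd_right hc 2))
  have h2 := key (a + b) (a' + b') (by
    rw [show a + b - (a' + b') = (a - a') + (b - b') by ring]
    exact dvd_add ha hb)
  have h3 := key (a + c) (a' + c') (by
    rw [show a + c - (a' + c') = (a - a') + (c - c') by ring]
    exact dvd_add ha hc)
  rw [show thetaNum p a b c - thetaNum p a' b' c' =
      ((a - b + 2 * c) ^ p - (a' - b' + 2 * c') ^ p) + ((a + b) ^ p - (a' + b') ^ p) -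
        2 * ((a + c) ^ p - (a' + c') ^ p) by simp only [thetaNum]; ring]
  exact dvd_sub (dvd_add h1 h2) (dvd_mul_of_dvd_right h3 2)

/-- Any integer representatives may be used. -/
theorem thetaVal_eq {p : ℕ} [NeZero p] (a b c : ℤ) :
    thetaVal p a b c = (a - b) * ((thetaNum p a b c / p : ℤ) : ZMod p) := by
  have hp : (p : ℤ) ≠ 0 := by exact_mod_cast NeZero.ne p
  have hd : ∀ x : ℤ, (p : ℤ) ∣ ((x : ZMod p).val : ℤ) - x := by
    intro x
    rw [← ZMod.intCast_zmod_eq_zero_iff_dvd]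
    simp
  obtain ⟨t, ht⟩ := thetaNum_congr (hd a) (hd b) (hd c)
  have h : thetaNum p (a : ZMod p).val (b : ZMod p).val (c : ZMod p).val =
      thetaNum p a b c + p * (p * t) := by linear_combination ht
  rw [thetaVal, h, Int.add_mul_ediv_left _ _ hp]
  simp

theorem thetaVal_degenerate {p : ℕ} [NeZero p] (a b : ZMod p) : thetaVal p a b b = 0 := by
  have h : thetaNum p a.val b.val b.val = 0 := by simp only [thetaNum]; ring
  rw [thetaVal, h]
  simp

theorem thetaVal_rho_left {p : ℕ} [NeZero p] (a b c : ZMod p) :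
    thetaVal p a b c + thetaVal p b a (tribracket a b c) = 0 := by
  obtain ⟨x, rfl⟩ := ZMod.intCast_surjective a
  obtain ⟨y, rfl⟩ := ZMod.intCast_surjective b
  obtain ⟨z, rfl⟩ := ZMod.intCast_surjective c
  have e : (tribracket x y z : ZMod p) = ((x - y + z : ℤ) : ZMod p) := by simp [tribracket]
  have h : thetaNum p y x (x - y + z) = thetaNum p x y z := by
    simp only [thetaNum]
    ring_nf
  rw [e, thetaVal_eq, thetaVal_eq, h]
  ring

theorem thetaVal_rho_right {p : ℕ} [NeZero p] (a b c : ZMod p) :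
    thetaVal p a b c + thetaVal p c (tribracket a b c) a = 0 := by
  obtain ⟨x, rfl⟩ := ZMod.intCast_surjective a
  obtain ⟨y, rfl⟩ := ZMod.intCast_surjective b
  obtain ⟨z, rfl⟩ := ZMod.intCast_surjective c
  have e : (tribracket x y z : ZMod p) = ((x - y + z : ℤ) : ZMod p) := by simp [tribracket]
  have h : thetaNum p z (x - y + z) x = thetaNum p x y z := by
    simp only [thetaNum]
    ring_nf
  rw [e, thetaVal_eq, thetaVal_eq, h]
  push_cast
  ring

/-- The homomorphism `θ_p` on the symmetric local biquandle 2-chains. -/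
def theta (p : ℕ) [NeZero p] : C2SLB p →+ ZMod p :=
  QuotientAddGroup.lift (D2lb p ⊔ D2rho p)
    (FreeAbelianGroup.lift fun t => thetaVal p t.1 t.2.1 t.2.2) (by
      rw [sup_le_iff, D2lb, D2rho, AddSubgroup.closure_le, AddSubgroup.closure_le]
      refine ⟨?_, ?_⟩
      · rintro x ⟨a, b, rfl⟩
        simp [pairGen, AddMonoidHom.mem_ker, thetaVal_degenerate]
      · rintro x (⟨a, b, c, rfl⟩ | ⟨a, b, c, rfl⟩)
        · simp [pairGen, AddMonoidHom.mem_ker, thetaVal_rho_left]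
        · simp [pairGen, AddMonoidHom.mem_ker, thetaVal_rho_right])

/-! ### Corner functions -/

/-! Whether `θ_p` vanishes on some nontrivial coloring (`HasZero`) is a property of the knot.
Reidemeister moves carry colorings to colorings in both directions, keep nontriviality and keep the
value of `θ_p`; for the third move this is the cocycle condition (`KnotDiagram.Step.hasZero_iff`).
So it suffices that a diagram with a nontrivial coloring by at most `⌊log₂ p⌋ + 2` colors has some
nontrivial coloring, possibly a different one, on which `θ_p` vanishes.

The number of colors is first reduced. Let `S` be the set of colors and `f : S → 𝔽₂` a function that
respects every relation `a + b = c + d` in `S`. Composed with the coloring, `f` satisfies the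
coloring condition modulo 2, and on a diagram with one component this leaves only constants and
checkerboards (`parity_cases`). If `f` is not constant on `S`, it is a checkerboard, so black and
white regions use disjoint sets of colors. Adding `s` to the black colors and `-s` to the white ones
keeps all Fox colors, and a suitable `s` merges a black color with a white one. Repeating this ends
with a set of colors on which only constant `f` exist, a parity rigid set (`exists_isParityRigid`).

Rigidity is affine invariant and can be tested by linear algebra over `𝔽₂`. A small rigid set with a
three-term progression is normalized to contain `0, 1, 2`, one without to contain `0, 1`. An
exhaustive search shows that the second kind does not occur and that the first kind maps into one of
a few listed sets (`IsParityRigid.exists_affine`). On each listed set `θ_p` is the coboundary of an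
antisymmetric function of two adjacent colors, so the contributions of the crossings cancel along
the semi-arcs (`thetaSum_eq_zero_of_coboundary`). The affine image of the reduced coloring is
therefore the coloring sought. -/

/-- The corner (or dart) reached by `s` quarter turns. -/
abbrev turn {V : Type*} (d : V × ZMod 4) (s : ZMod 4) : V × ZMod 4 := (d.1, d.2 + s)

/-- A Dehn coloring, as a function of the corners: it is constant around each region, and the
coloring condition holds at every crossing. -/
structure IsCornerColoring {V : Type*} {p : ℕ} (glue : V × ZMod 4 → V × ZMod 4)
    (F : V × ZMod 4 → ZMod p) : Prop where
  face : ∀ d, F (turn (glue d) (-1)) = F d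
  crossing : ∀ v, F (v, 0) + F (v, 1) = F (v, 2) + F (v, 3)

/-- All semi-arcs have the same Fox color (the sum of the colors on their two sides). -/
def IsFoxConstant {V : Type*} {p : ℕ} (F : V × ZMod 4 → ZMod p) : Prop :=
  ∃ s, ∀ d, F d + F (turn d (-1)) = s

/-- The value of `θ_p` on the chain of a corner coloring. -/
def thetaSum {V : Type*} [Fintype V] {p : ℕ} (F : V × ZMod 4 → ZMod p) : ZMod p :=
  ∑ v, thetaVal p (F (v, 0)) (F (v, 3)) (F (v, 1))

/-- There is a nontrivial coloring on which `θ_p` vanishes. -/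
def HasZero {V : Type*} [Fintype V] (p : ℕ) (glue : V × ZMod 4 → V × ZMod 4) : Prop :=
  ∃ F : V × ZMod 4 → ZMod p, IsCornerColoring glue F ∧ ¬ IsFoxConstant F ∧ thetaSum F = 0

theorem ZMod.four_cases (k : ZMod 4) : k = 0 ∨ k = 1 ∨ k = 2 ∨ k = 3 := by
  revert k; decide

theorem isFoxConstant_iff_corners {V : Type*} {p : ℕ} {F : V × ZMod 4 → ZMod p} :
    IsFoxConstant F ↔ ∃ s, ∀ v, F (v, 0) + F (v, 3) = s ∧ F (v, 1) + F (v, 0) = s ∧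
      F (v, 2) + F (v, 1) = s ∧ F (v, 3) + F (v, 2) = s := by
  constructor
  · rintro ⟨s, h⟩
    exact ⟨s, fun v => ⟨h (v, 0), h (v, 1), h (v, 2), h (v, 3)⟩⟩
  · rintro ⟨s, h⟩
    refine ⟨s, ?_⟩
    rintro ⟨v, k⟩
    obtain ⟨h0, h1, h2, h3⟩ := h v
    rcases ZMod.four_cases k with rfl | rfl | rfl | rfl
    · exact h0
    · exact h1
    · exact h2
    · exact h3

theorem Equiv.Perm.SameCycle.apply_eq_apply {α β : Type*} {σ : Equiv.Perm α} {φ : α → β}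
    (h : ∀ a, φ (σ a) = φ a) {a b : α} (hab : σ.SameCycle a b) : φ a = φ b := by
  obtain ⟨i, rfl⟩ := hab
  induction i using Int.induction_on generalizing a with
  | zero => rfl
  | succ i ih => rw [zpow_add_one, Equiv.Perm.mul_apply, ← ih, h]
  | pred i ih =>
    have h' : φ (σ⁻¹ a) = φ a := (h (σ⁻¹ a)).symm.trans (congrArg φ (σ.apply_symm_apply a))
    rw [zpow_sub_one, Equiv.Perm.mul_apply, ← ih, h']

/-! ### Colorings of diagrams as functions of the corners -/

namespace KnotDiagram

variable (D : KnotDiagram)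

theorem regionOf_face (d : Dart D.n) : D.regionOf (D.face d) = D.regionOf d :=
  Quotient.sound (Equiv.Perm.SameCycle.symm ⟨1, rfl⟩)

/-- A function of the corners that is constant around the regions is a function of the regions. -/
theorem exists_regionOf_comp {α : Type*} (F : Dart D.n → α) (h : ∀ d, F (D.face d) = F d) :
    ∃ C : D.Region → α, ∀ d, C (D.regionOf d) = F d := by
  exact ⟨Quotient.lift F fun a b hab => Equiv.Perm.SameCycle.apply_eq_apply h hab, fun d => rfl⟩

/-- A function of the semi-arcs that does not change at the crossings is constant. -/
theorem const_of_glue_rot {α : Type*} (φ : Dart D.n → α) (h1 : ∀ d, φ (D.glue d) = φ d)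
    (h2 : ∀ d : Dart D.n, φ (turn d 2) = φ d) (a b : Dart D.n) : φ a = φ b := by
  have h : ∀ d, φ ((D.glue.trans (Dart.rotPerm D.n 2)) d) = φ d := fun d =>
    (h2 (D.glue d)).trans (h1 d)
  rcases D.one_component a b with hab | hab
  · exact hab.apply_eq_apply h
  · rw [hab.apply_eq_apply h, h1]

variable {D} {p : ℕ}

/-- Seen from its other end, a semi-arc has the same two regions at its sides, exchanged. So the Fox
color belongs to the semi-arc and not to the dart. -/
theorem fox_glue {α : Type*} [AddCommMonoid α] {F : Dart D.n → α}
    (h : ∀ d, F (turn (D.glue d) (-1)) = F d) (d : Dart D.n) :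
    F (D.glue d) + F (turn (D.glue d) (-1)) = F d + F (turn d (-1)) := by
  have h' := h (D.glue d)
  rw [D.glue_glue] at h'
  rw [h d, ← h', add_comm]

/-- The four choices of `x₁` at a crossing give the same equation up to order, so one equation per
crossing is enough. -/
theorem isDehnColoring_iff (C : D.Region → ZMod p) :
    D.IsDehnColoring p C ↔ IsCornerColoring D.glue fun d => C (D.regionOf d) := by
  constructor
  · intro h
    refine ⟨fun d => congrArg C (D.regionOf_face d), fun v => ?_⟩
    have h0 : C (D.regionOf (v, 0)) + C (D.regionOf (v, 1)) =
      C (D.regionOf (v, 3)) + C (D.regionOf (v, 2)) := h (v, 0)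
    rw [h0, add_comm]
  · rintro ⟨-, h⟩ ⟨v, k⟩
    have hv := h v
    rcases ZMod.four_cases k with rfl | rfl | rfl | rfl
    · change C (D.regionOf (v, 0)) + C (D.regionOf (v, 1)) =
        C (D.regionOf (v, 3)) + C (D.regionOf (v, 2))
      rw [hv, add_comm]
    · change C (D.regionOf (v, 1)) + C (D.regionOf (v, 0)) =
        C (D.regionOf (v, 2)) + C (D.regionOf (v, 3))
      rw [← hv, add_comm]
    · change C (D.regionOf (v, 2)) + C (D.regionOf (v, 3)) =
        C (D.regionOf (v, 1)) + C (D.regionOf (v, 0))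
      rw [← hv, add_comm]
    · change C (D.regionOf (v, 3)) + C (D.regionOf (v, 2)) =
        C (D.regionOf (v, 0)) + C (D.regionOf (v, 1))
      rw [hv, add_comm]

/-- A crossing is trivially colored when the Fox color does not change along either strand through
it. Since there is only one component, the Fox color is then the same everywhere. Conversely,
subtracting the Fox sums of consecutive darts gives equal opposite corners. -/
theorem isTrivialColoring_iff {C : D.Region → ZMod p} (hC : D.IsDehnColoring p C) :
    D.IsTrivialColoring p C ↔ IsFoxConstant fun d => C (D.regionOf d) := by
  have hF := (isDehnColoring_iff C).1 hC
  constructor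
  · intro h
    rcases isEmpty_or_nonempty (Dart D.n) with he | ⟨⟨d₀⟩⟩
    · exact ⟨0, fun d => he.elim d⟩
    refine ⟨_, fun d => D.const_of_glue_rot
      (fun d => C (D.regionOf d) + C (D.regionOf (turn d (-1)))) 
      (fox_glue (F := fun d => C (D.regionOf d)) hF.face) ?_ d d₀⟩
    rintro ⟨v, k⟩
    have h0 : C (D.regionOf (v, 0)) = C (D.regionOf (v, 2)) := (h (v, 0)).1
    have h1 : C (D.regionOf (v, 1)) = C (D.regionOf (v, 3)) := (h (v, 1)).1
    rcases ZMod.four_cases k with rfl | rfl | rfl | rfl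
    · change C (D.regionOf (v, 2)) + C (D.regionOf (v, 1)) =
        C (D.regionOf (v, 0)) + C (D.regionOf (v, 3))
      rw [h0, h1]
    · change C (D.regionOf (v, 3)) + C (D.regionOf (v, 2)) =
        C (D.regionOf (v, 1)) + C (D.regionOf (v, 0))
      rw [h0, h1]
    · change C (D.regionOf (v, 0)) + C (D.regionOf (v, 3)) =
        C (D.regionOf (v, 2)) + C (D.regionOf (v, 1))
      rw [h0, h1]
    · change C (D.regionOf (v, 1)) + C (D.regionOf (v, 0)) =
        C (D.regionOf (v, 3)) + C (D.regionOf (v, 2))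
      rw [h0, h1]
  · rw [isFoxConstant_iff_corners]
    rintro ⟨s, h⟩ ⟨v, k⟩
    obtain ⟨a0, a1, a2, a3⟩ := h v
    have e02 : C (D.regionOf (v, 0)) = C (D.regionOf (v, 2)) := by linear_combination a0 - a3
    have e13 : C (D.regionOf (v, 1)) = C (D.regionOf (v, 3)) := by linear_combination a1 - a0
    rcases ZMod.four_cases k with rfl | rfl | rfl | rfl
    · exact ⟨e02, e13⟩
    · exact ⟨e13, e02⟩
    · exact ⟨e02.symm, e13.symm⟩
    · exact ⟨e13.symm, e02.symm⟩

/-- The specified corner `(v, 0)` starts at an under-dart, so all signs are positive; its neighbors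
across the under- and the over-strand are the corners `3` and `1`. -/
theorem theta_W [NeZero p] (C : D.Region → ZMod p) :
    theta p (D.W C) = thetaSum fun d => C (D.regionOf d) := by
  rw [W, map_sum, thetaSum]
  refine Finset.sum_congr rfl fun v _ => ?_
  have hn : ¬ Dart.IsOver ((v, 0) : Dart D.n) := by
    simp only [Dart.IsOver]; decide
  simp only [weight, hn, if_false, underNbr, overNbr]
  simp [theta, pairGen]
  rfl

/-- Only the existence of a zero matters, not its multiplicity. This form can be carried along the
moves without matching whole multisets. -/
theorem zero_mem_PhiNT_iff [NeZero p] :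
    (0 : ZMod p) ∈ D.PhiNT (theta p) ↔ HasZero p D.glue := by
  simp only [PhiNT, Multiset.mem_map, Finset.mem_val, Set.Finite.mem_toFinset, ColNT,
    Set.mem_ofPred_eq, theta_W]
  constructor
  · rintro ⟨C, ⟨h1, h2⟩, h3⟩
    exact ⟨_, (isDehnColoring_iff C).1 h1, fun h => h2 ((isTrivialColoring_iff h1).2 h), h3⟩
  · rintro ⟨F, h1, h2, h3⟩
    obtain ⟨C, hC⟩ := D.exists_regionOf_comp F h1.face
    obtain rfl : (fun d => C (D.regionOf d)) = F := funext hC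
    have h1' := (isDehnColoring_iff C).2 h1
    exact ⟨C, ⟨h1', fun h => h2 ((isTrivialColoring_iff h1').1 h)⟩, h3⟩

end KnotDiagram

/-! ### A crossing seen from any of its corners -/

section Local

variable {V : Type*} {p : ℕ}

theorem turn_turn (d : V × ZMod 4) (s t : ZMod 4) : turn (turn d s) t = turn d (s + t) := by
  simp only [turn, add_assoc]

theorem turn_zero (d : V × ZMod 4) : turn d 0 = d := by
  simp only [turn, add_zero]

/-- A half turn only exchanges the two sides of the coloring condition. The parity of a corner tells
whether its first dart is under (even) or over (odd), and this decides which neighbor is added to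
it. -/
theorem crossing_iff_of_even {F : V × ZMod 4 → ZMod p} {d : V × ZMod 4} (h : d.2 = 0 ∨ d.2 = 2) :
    F (d.1, 0) + F (d.1, 1) = F (d.1, 2) + F (d.1, 3) ↔
      F d + F (turn d 1) = F (turn d 2) + F (turn d 3) := by
  obtain ⟨v, k⟩ := d
  rcases h with h | h <;> (dsimp only at h; subst h)
  · exact Iff.rfl
  · exact eq_comm

theorem crossing_iff_of_odd {F : V × ZMod 4 → ZMod p} {d : V × ZMod 4} (h : d.2 = 1 ∨ d.2 = 3) :
    F (d.1, 0) + F (d.1, 1) = F (d.1, 2) + F (d.1, 3) ↔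
      F d + F (turn d 3) = F (turn d 1) + F (turn d 2) := by
  obtain ⟨v, k⟩ := d
  rcases h with h | h <;> (dsimp only at h; subst h)
  · change _ ↔ F (v, 1) + F (v, 0) = F (v, 2) + F (v, 3)
    rw [add_comm (F (v, 1))]
  · change _ ↔ F (v, 3) + F (v, 2) = F (v, 0) + F (v, 1)
    rw [add_comm (F (v, 3)), eq_comm]

variable [NeZero p]

/-- These are the two relations of `D2rho`: by the coloring condition the fourth corner is the
tribracket of the others, and a quarter turn in either direction changes the sign. -/
theorem thetaVal_rotate {c₀ c₁ c₂ c₃ : ZMod p} (h : c₀ + c₁ = c₂ + c₃) :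
    thetaVal p c₀ c₃ c₁ = -thetaVal p c₁ c₂ c₀ ∧ thetaVal p c₀ c₃ c₁ = -thetaVal p c₃ c₀ c₂ := by
  have e : tribracket c₀ c₃ c₁ = c₂ := by
    simp only [tribracket]
    linear_combination h
  constructor
  · have := thetaVal_rho_right c₀ c₃ c₁
    rw [e] at this
    exact eq_neg_of_add_eq_zero_left this
  · have := thetaVal_rho_left c₀ c₃ c₁
    rw [e] at this
    exact eq_neg_of_add_eq_zero_left this

theorem thetaVal_half_turn {c₀ c₁ c₂ c₃ : ZMod p} (h : c₀ + c₁ = c₂ + c₃) :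
    thetaVal p c₂ c₁ c₃ = thetaVal p c₀ c₃ c₁ := by
  rw [(thetaVal_rotate h).1, (thetaVal_rotate (c₀ := c₂) (c₁ := c₃) (c₂ := c₀) (c₃ := c₁) h.symm).2]

theorem thetaVal_of_even {F : V × ZMod 4 → ZMod p} {d : V × ZMod 4} (h : d.2 = 0 ∨ d.2 = 2)
    (hF : F (d.1, 0) + F (d.1, 1) = F (d.1, 2) + F (d.1, 3)) :
    thetaVal p (F (d.1, 0)) (F (d.1, 3)) (F (d.1, 1)) =
      thetaVal p (F d) (F (turn d 3)) (F (turn d 1)) := by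
  obtain ⟨v, k⟩ := d
  rcases h with h | h <;> (dsimp only at h; subst h)
  · rfl
  · exact (thetaVal_half_turn hF).symm

theorem thetaVal_of_odd {F : V × ZMod 4 → ZMod p} {d : V × ZMod 4} (h : d.2 = 1 ∨ d.2 = 3)
    (hF : F (d.1, 0) + F (d.1, 1) = F (d.1, 2) + F (d.1, 3)) :
    thetaVal p (F (d.1, 0)) (F (d.1, 3)) (F (d.1, 1)) =
      -thetaVal p (F d) (F (turn d 1)) (F (turn d 3)) := by
  obtain ⟨v, k⟩ := d
  rcases h with h | h <;> (dsimp only at h; subst h)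
  · exact (thetaVal_rotate hF).1
  · exact (thetaVal_rotate hF).2

end Local

/-! ### Renaming of crossings -/

section Pull

variable {V V' : Type*}

/-- The gluing `g'` in terms of the names given by `f`. -/
def pullGlue (f : V ≃ V') (g' : V' × ZMod 4 → V' × ZMod 4) (a : V × ZMod 4) : V × ZMod 4 :=
  (f.symm (g' (f a.1, a.2)).1, (g' (f a.1, a.2)).2)

theorem pullGlue_eq {f : V ≃ V'} {g' : V' × ZMod 4 → V' × ZMod 4} {a b : V × ZMod 4}
    (h : g' (f a.1, a.2) = (f b.1, b.2)) : pullGlue f g' a = b := by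
  simp [pullGlue, h]

theorem pullGlue_pullGlue {f : V ≃ V'} {g' : V' × ZMod 4 → V' × ZMod 4}
    (h : ∀ e, g' (g' e) = e) (a : V × ZMod 4) : pullGlue f g' (pullGlue f g' a) = a := by
  simp [pullGlue, h]

end Pull

section Renaming

variable {V V' : Type*} [Fintype V] [Fintype V'] {p : ℕ} [NeZero p]

/-- Crossings may be renamed and turned by half turns. -/
theorem HasZero.of_iso {g : V × ZMod 4 → V × ZMod 4} {g' : V' × ZMod 4 → V' × ZMod 4}
    (f : V ≃ V') (s : V → ZMod 4) (hs : ∀ v, s v = 0 ∨ s v = 2)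
    (h : ∀ a : V × ZMod 4, g' (f a.1, a.2 + s a.1) = (f (g a).1, (g a).2 + s (g a).1))
    (hz : HasZero p g) : HasZero p g' := by
  obtain ⟨F, hF, hn, h0⟩ := hz
  have hss : ∀ v (k : ZMod 4), k + s v + s v = k := by
    intro v k
    rcases hs v with h | h <;> rw [h] <;> revert k <;> decide
  let F' : V' × ZMod 4 → ZMod p := fun e => F (f.symm e.1, e.2 + s (f.symm e.1))
  have hF' : ∀ v k, F' (f v, k + s v) = F (v, k) := by
    intro v k
    simp only [F', Equiv.symm_apply_apply, hss]
  have hcr : ∀ v, F' (f v, 0) + F' (f v, 1) = F' (f v, 2) + F' (f v, 3) := by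
    intro v
    simp only [F', Equiv.symm_apply_apply]
    rcases hs v with h | h <;> rw [h]
    · exact hF.crossing v
    · exact (hF.crossing v).symm
  refine ⟨F', ⟨?_, fun v' => ?_⟩, ?_, ?_⟩
  · rintro ⟨v', k⟩
    obtain ⟨v, rfl⟩ := f.surjective v'
    obtain ⟨k, rfl⟩ : ∃ j, k = j + s v := ⟨k + s v, (hss v k).symm⟩
    rw [h (v, k), hF', ← hF.face (v, k)]
    simp only [turn]
    rw [add_right_comm, hF']
  · obtain ⟨v, rfl⟩ := f.surjective v'
    exact hcr v
  · rintro ⟨c, hc⟩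
    refine hn ⟨c, ?_⟩
    rintro ⟨v, k⟩
    have := hc (f v, k + s v)
    simp only [turn] at this ⊢
    rwa [add_right_comm, hF', hF'] at this
  · rw [← h0, thetaSum, thetaSum, ← Equiv.sum_comp f]
    refine Finset.sum_congr rfl fun v _ => ?_
    have h2 := hF.crossing v
    simp only [F', Equiv.symm_apply_apply]
    rcases hs v with h | h <;> rw [h]
    · rfl
    · exact thetaVal_half_turn h2

theorem hasZero_pullGlue (f : V ≃ V') (g' : V' × ZMod 4 → V' × ZMod 4) :
    HasZero p (pullGlue f g') ↔ HasZero p g' := by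
  constructor
  · refine HasZero.of_iso f (fun _ => 0) (fun _ => Or.inl rfl) fun a => ?_
    simp [pullGlue]
  · refine HasZero.of_iso f.symm (fun _ => 0) (fun _ => Or.inl rfl) fun a => ?_
    simp [pullGlue]

end Renaming

/-! ### The first Reidemeister move -/

section Kink

variable {V : Type*} [Fintype V] {p : ℕ} [NeZero p] {g : V × ZMod 4 → V × ZMod 4}
  {g' : Option V × ZMod 4 → Option V × ZMod 4} {d : V × ZMod 4} {k : ZMod 4}

theorem add_one_add_neg_one (k : ZMod 4) :
    k + 1 + -1 = k ∧ k + 2 + -1 = k + 1 ∧ k + 3 + -1 = k + 2 ∧ k + -1 = k + 3 := by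
  revert k; decide

/-- The first Reidemeister move. -/
theorem hasZero_kink (hg : ∀ a, g (g a) = a) (hg' : ∀ a, g' (g' a) = a)
    (h1 : g' (none, k) = (none, k + 1)) (h2 : g' (none, k + 2) = (some d.1, d.2))
    (h3 : g' (none, k + 3) = (some (g d).1, (g d).2))
    (h4 : ∀ a, a ≠ d → a ≠ g d → g' (some a.1, a.2) = (some (g a).1, (g a).2)) :
    HasZero p g ↔ HasZero p g' := by
  have h1' : g' (none, k + 1) = (none, k) := by rw [← h1, hg']
  have h2' : g' (some d.1, d.2) = (none, k + 2) := by rw [← h2, hg']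
  have h3' : g' (some (g d).1, (g d).2) = (none, k + 3) := by rw [← h3, hg']
  obtain ⟨k1, k2, k3, k4⟩ := add_one_add_neg_one k
  constructor
  · rintro ⟨F, hF, hn, h0⟩
    -- At the new crossing the corners `k + 1` and `k + 3` lie in the region on the left of `d`, and
    -- `k + 2` in that on its right. The corner `k` is the loop, whose color must then equal that of
    -- the opposite corner `k + 2`.
    let F' : Option V × ZMod 4 → ZMod p := fun e =>
      match e.1 with
      | some v => F (v, e.2)
      | none => if e.2 - k = 1 ∨ e.2 - k = 3 then F d else F (turn d (-1))
    have hsome : ∀ v j, F' (some v, j) = F (v, j) := fun _ _ => rfl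
    have hnone : ∀ j, F' (none, j) = if j - k = 1 ∨ j - k = 3 then F d else F (turn d (-1)) :=
      fun _ => rfl
    have hper : ∀ j, F' (none, j + 2) = F' (none, j) := by
      intro j
      rw [hnone, hnone]
      have : ∀ i k : ZMod 4, i + 2 - k = 1 ∨ i + 2 - k = 3 ↔ i - k = 1 ∨ i - k = 3 := by decide
      exact if_congr (this j k) rfl rfl
    have v1 : F' (none, k + 1) = F d := by
      rw [hnone, if_pos]; left; ring
    have v2 : F' (none, k + 2) = F (turn d (-1)) := by
      rw [hnone, if_neg]; rw [add_sub_cancel_left]; decide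
    have v3 : F' (none, k + 3) = F d := by
      rw [hnone, if_pos]; right; ring
    have hgd : F (g d) = F (turn d (-1)) := by
      rw [← hF.face (g d), hg]
    have e02 : F' (none, 2) = F' (none, 0) := hper 0
    have e13 : F' (none, 3) = F' (none, 1) := hper 1
    refine ⟨F', ⟨?_, ?_⟩, ?_, ?_⟩
    · rintro ⟨_ | v, j⟩
      · obtain ⟨i, rfl⟩ : ∃ i, j = k + i := ⟨j - k, by ring⟩
        rcases ZMod.four_cases i with rfl | rfl | rfl | rfl
        · rw [add_zero, h1, turn, k1]
        · rw [h1', turn, k4, v3, v1]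
        · rw [h2, v2]
        · rw [h3, v3]
          exact hF.face d
      · by_cases e1 : ((v, j) : V × ZMod 4) = d
        · subst e1
          rw [h2', turn, k2, v1]
        by_cases e2 : ((v, j) : V × ZMod 4) = g d
        · have := h3'
          rw [← e2] at this
          rw [this, turn, k3, v2, hsome, e2, hgd]
        · rw [h4 (v, j) e1 e2]
          exact hF.face (v, j)
    · rintro (_ | v)
      · rw [e02, e13]
      · exact hF.crossing v
    · rintro ⟨s, hs⟩
      exact hn ⟨s, fun a => hs (some a.1, a.2)⟩
    -- The neighbors `3` and `1` of the specified corner have equal colors, so the new crossing has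
    -- a degenerate weight.
    · rw [thetaSum, Fintype.sum_option, e13, thetaVal_degenerate, zero_add]
      exact h0
  · rintro ⟨F', hF', hn, h0⟩
    have q1 : F' (none, k + 3) = F' (none, k + 1) := by
      have := hF'.face (none, k + 1)
      rwa [h1', turn, k4] at this
    have q2 : F' (none, k + 1) = F' (some d.1, d.2) := by
      have := hF'.face (some d.1, d.2)
      rwa [h2', turn, k2] at this
    have q3 : F' (none, k + 2) = F' (some (g d).1, (g d).2) := by
      have := hF'.face (some (g d).1, (g d).2)
      rwa [h3', turn, k3] at this
    have q4 := hF'.face (none, k + 3)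
    rw [h3] at q4
    have q5 := hF'.face (none, k + 2)
    rw [h2] at q5
    have hcr := hF'.crossing none
    -- One pair of opposite corners lies in a single region; the coloring condition gives equality
    -- for the other pair.
    have e : F' (none, 2) = F' (none, 0) ∧ F' (none, 3) = F' (none, 1) := by
      rcases ZMod.four_cases k with rfl | rfl | rfl | rfl
      · have q : F' (none, 3) = F' (none, 1) := q1
        exact ⟨by linear_combination -hcr - q, q⟩
      · have q : F' (none, 0) = F' (none, 2) := q1
        exact ⟨q.symm, by linear_combination -hcr + q⟩
      · have q : F' (none, 1) = F' (none, 3) := q1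
        exact ⟨by linear_combination -hcr + q, q.symm⟩
      · have q : F' (none, 2) = F' (none, 0) := q1
        exact ⟨q, by linear_combination -hcr - q⟩
    refine ⟨fun a => F' (some a.1, a.2), ⟨fun a => ?_, fun v => hF'.crossing (some v)⟩, ?_, ?_⟩
    · by_cases e1 : a = d
      · subst e1
        exact q4.trans (q1.trans q2)
      by_cases e2 : a = g d
      · subst e2
        rw [hg]
        exact q5.trans q3
      · have := hF'.face (some a.1, a.2)
        rw [h4 a e1 e2] at this
        exact this
    · rintro ⟨s, hs⟩
      refine hn (isFoxConstant_iff_corners.2 ⟨s, ?_⟩)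
      have hd : F' (none, k + 1) + F' (none, k + 2) = s := by
        rw [q2, ← q5]
        exact hs d
      have hd' : F' (none, 0) + F' (none, 1) = s := by
        rcases ZMod.four_cases k with rfl | rfl | rfl | rfl
        · have q : F' (none, 1) + F' (none, 2) = s := hd
          rw [← e.1, add_comm, q]
        · have q : F' (none, 2) + F' (none, 3) = s := hd
          rw [← e.1, ← e.2, q]
        · have q : F' (none, 3) + F' (none, 0) = s := hd
          rw [← e.2, add_comm, q]
        · exact hd
      rintro (_ | v)
      · exact ⟨by rw [e.2, hd'], by rw [add_comm, hd'], by rw [e.1, hd'],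
          by rw [e.1, e.2, add_comm, hd']⟩
      · exact ⟨hs (v, 0), hs (v, 1), hs (v, 2), hs (v, 3)⟩
    · rw [thetaSum, Fintype.sum_option, e.2, thetaVal_degenerate, zero_add] at h0
      exact h0

end Kink

/-! ### The second Reidemeister move -/

section Poke

variable {V : Type*} [Fintype V] {p : ℕ} [NeZero p] {g : V × ZMod 4 → V × ZMod 4}
  {g' : (V ⊕ Fin 2) × ZMod 4 → (V ⊕ Fin 2) × ZMod 4} {a b : V × ZMod 4}

/-- The second Reidemeister move. -/
theorem hasZero_poke (hg : ∀ c, g (g c) = c) (hg' : ∀ c, g' (g' c) = c)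
    (hab : ∀ F : V × ZMod 4 → ZMod p, IsCornerColoring g F → F a = F b)
    (h1 : g' (Sum.inr 0, 3) = (Sum.inl a.1, a.2))
    (h2 : g' (Sum.inr 0, 1) = (Sum.inr 1, 1))
    (h3 : g' (Sum.inr 1, 3) = (Sum.inl (g a).1, (g a).2))
    (h4 : g' (Sum.inr 1, 0) = (Sum.inl b.1, b.2))
    (h5 : g' (Sum.inr 1, 2) = (Sum.inr 0, 0))
    (h6 : g' (Sum.inr 0, 2) = (Sum.inl (g b).1, (g b).2))
    (h7 : ∀ c, c ≠ a → c ≠ g a → c ≠ b → c ≠ g b →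
      g' (Sum.inl c.1, c.2) = (Sum.inl (g c).1, (g c).2)) :
    HasZero p g ↔ HasZero p g' := by
  have i1 : g' (Sum.inl a.1, a.2) = (Sum.inr 0, 3) := by rw [← h1, hg']
  have i2 : g' (Sum.inr 1, 1) = (Sum.inr 0, 1) := by rw [← h2, hg']
  have i3 : g' (Sum.inl (g a).1, (g a).2) = (Sum.inr 1, 3) := by rw [← h3, hg']
  have i4 : g' (Sum.inl b.1, b.2) = (Sum.inr 1, 0) := by rw [← h4, hg']
  have i5 : g' (Sum.inr 0, 0) = (Sum.inr 1, 2) := by rw [← h5, hg']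
  have i6 : g' (Sum.inl (g b).1, (g b).2) = (Sum.inr 0, 2) := by rw [← h6, hg']
  -- The weights of the two new crossings differ by one of the `ρ` relations, so they cancel.
  have hcancel : ∀ {n m l r : ZMod p}, n + m = l + r →
      thetaVal p n r m + thetaVal p m l n = 0 := by
    intro n m l r h
    have := thetaVal_rho_right n r m
    rwa [show tribracket n r m = l by simp only [tribracket]; linear_combination h] at this
  constructor
  · rintro ⟨F, hF, hn, h0⟩
    have hL := hab F hF
    -- The corners `X 0` and `Y 1` form the new bigon, whose color is forced by the coloring
    -- condition. `X 2` and `Y 3` are in the two pieces of the old common region, `X 1` and `Y 0` on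
    -- the right of `b`, `X 3` and `Y 2` on the right of `a`.
    let X : ZMod 4 → ZMod p := fun j => if j = 0 then F (turn a (-1)) + F a - F (turn b (-1)) else
      if j = 1 then F (turn b (-1)) else if j = 2 then F a else F (turn a (-1))
    let Y : ZMod 4 → ZMod p := fun j => if j = 1 then F (turn a (-1)) + F a - F (turn b (-1)) else
      if j = 0 then F (turn b (-1)) else if j = 3 then F a else F (turn a (-1))
    let F' : (V ⊕ Fin 2) × ZMod 4 → ZMod p := fun e =>
      Sum.elim (fun v => F (v, e.2)) (fun i => if i = 0 then X e.2 else Y e.2) e.1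
    have hga : F (g a) = F (turn a (-1)) := by rw [← hF.face (g a), hg]
    have hgb : F (g b) = F (turn b (-1)) := by rw [← hF.face (g b), hg]
    have hinl : ∀ c : V × ZMod 4, F' (Sum.inl c.1, c.2) = F c := fun _ => rfl
    have x0 : F' (Sum.inr 0, 0) = F (turn a (-1)) + F a - F (turn b (-1)) := rfl
    have x1 : F' (Sum.inr 0, 1) = F (turn b (-1)) := rfl
    have x2 : F' (Sum.inr 0, 2) = F a := rfl
    have x3 : F' (Sum.inr 0, 3) = F (turn a (-1)) := rfl
    have y0 : F' (Sum.inr 1, 0) = F (turn b (-1)) := rfl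
    have y1 : F' (Sum.inr 1, 1) = F (turn a (-1)) + F a - F (turn b (-1)) := rfl
    have y2 : F' (Sum.inr 1, 2) = F (turn a (-1)) := rfl
    have y3 : F' (Sum.inr 1, 3) = F a := rfl
    refine ⟨F', ⟨?_, ?_⟩, ?_, ?_⟩
    · rintro ⟨v | i, j⟩
      · by_cases e1 : ((v, j) : V × ZMod 4) = a
        · subst e1
          rw [i1]
          exact x2
        by_cases e2 : ((v, j) : V × ZMod 4) = g a
        · rw [← e2] at i3 hga
          rw [i3]
          exact y2.trans hga.symm
        by_cases e3 : ((v, j) : V × ZMod 4) = b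
        · subst e3
          rw [i4]
          exact y3.trans hL
        by_cases e4 : ((v, j) : V × ZMod 4) = g b
        · rw [← e4] at i6 hgb
          rw [i6]
          exact x1.trans hgb.symm
        · rw [h7 (v, j) e1 e2 e3 e4]
          exact hF.face (v, j)
      · have hi : i = 0 ∨ i = 1 := by revert i; decide
        rcases hi with rfl | rfl <;> rcases ZMod.four_cases j with rfl | rfl | rfl | rfl
        · rw [i5]; exact y1.trans x0.symm
        · rw [h2]; exact y0.trans x1.symm
        · rw [h6]; exact (hF.face b).trans hL.symm
        · rw [h1]; rfl
        · rw [h4]; rfl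
        · rw [i2]; exact x0.trans y1.symm
        · rw [h5]; exact x3.trans y2.symm
        · rw [h3]; exact hF.face a
    · rintro (v | i)
      · exact hF.crossing v
      · have hi : i = 0 ∨ i = 1 := by revert i; decide
        rcases hi with rfl | rfl
        · rw [x0, x1, x2, x3]; ring
        · rw [y0, y1, y2, y3]; ring
    · rintro ⟨s, hs⟩
      exact hn ⟨s, fun c => hs (Sum.inl c.1, c.2)⟩
    · rw [thetaSum, Fintype.sum_sum_type, Fin.sum_univ_two, x0, x1, x3, y0, y1, y3,
        hcancel (l := F a) (by ring), add_zero]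
      exact h0
  · rintro ⟨F', hF', hn, h0⟩
    have qa := hF'.face (Sum.inl a.1, a.2)
    have qb := hF'.face (Sum.inl b.1, b.2)
    have qa' := hF'.face (Sum.inl (g a).1, (g a).2)
    have qb' := hF'.face (Sum.inl (g b).1, (g b).2)
    have q00 := hF'.face (Sum.inr 0, 0)
    have q01 := hF'.face (Sum.inr 0, 1)
    have q02 := hF'.face (Sum.inr 0, 2)
    have q03 := hF'.face (Sum.inr 0, 3)
    have q10 := hF'.face (Sum.inr 1, 0)
    have q12 := hF'.face (Sum.inr 1, 2)
    have q13 := hF'.face (Sum.inr 1, 3)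
    rw [i1] at qa
    rw [i4] at qb
    rw [i3] at qa'
    rw [i6] at qb'
    rw [i5] at q00
    rw [h2] at q01
    rw [h6] at q02
    rw [h1] at q03
    rw [h4] at q10
    rw [h5] at q12
    rw [h3] at q13
    have c0 := hF'.crossing (Sum.inr 0)
    have c1 := hF'.crossing (Sum.inr 1)
    change F' (Sum.inr 0, 2) = F' (Sum.inl a.1, a.2) at qa
    change F' (Sum.inr 1, 3) = F' (Sum.inl b.1, b.2) at qb
    change F' (Sum.inr 1, 2) = F' (Sum.inl (g a).1, (g a).2) at qa'
    change F' (Sum.inr 0, 1) = F' (Sum.inl (g b).1, (g b).2) at qb'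
    change F' (Sum.inr 1, 1) = F' (Sum.inr 0, 0) at q00
    change F' (Sum.inr 1, 0) = F' (Sum.inr 0, 1) at q01
    change F' (Sum.inr 0, 3) = F' (Sum.inr 1, 2) at q12
    -- The other three regions are common to both crossings, so the two pieces of the old region
    -- have the same color. Hence the coloring descends to the diagram before the move.
    have hL : F' (Sum.inr 0, 2) = F' (Sum.inr 1, 3) := by
      linear_combination -c0 + c1 - q00 - q01 - q12
    refine ⟨fun c => F' (Sum.inl c.1, c.2), ⟨fun c => ?_, fun v => hF'.crossing (Sum.inl v)⟩, ?_, ?_⟩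
    · by_cases e1 : c = a
      · subst e1
        exact q13.trans (hL.symm.trans qa)
      by_cases e2 : c = g a
      · subst e2
        rw [hg]
        exact q03.trans (q12.trans qa')
      by_cases e3 : c = b
      · subst e3
        exact q02.trans (hL.trans qb)
      by_cases e4 : c = g b
      · subst e4
        rw [hg]
        exact q10.trans (q01.trans qb')
      · have := hF'.face (Sum.inl c.1, c.2)
        rw [h7 c e1 e2 e3 e4] at this
        exact this
    · rintro ⟨s, hs⟩
      refine hn (isFoxConstant_iff_corners.2 ⟨s, ?_⟩)
      have sa : F' (Sum.inr 0, 2) + F' (Sum.inr 0, 3) = s := by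
        rw [qa, ← q03]
        exact hs a
      have sb : F' (Sum.inr 1, 3) + F' (Sum.inr 1, 0) = s := by
        rw [qb, ← q10]
        exact hs b
      rintro (v | i)
      · exact ⟨hs (v, 0), hs (v, 1), hs (v, 2), hs (v, 3)⟩
      · have hi : i = 0 ∨ i = 1 := by revert i; decide
        rcases hi with rfl | rfl
        · refine ⟨?_, ?_, ?_, ?_⟩
          · linear_combination c0 - sb + 2 * sa - hL + q01
          · linear_combination c0 + sa
          · linear_combination sb + hL - q01
          · linear_combination sa
        · refine ⟨?_, ?_, ?_, ?_⟩
          · linear_combination sb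
          · linear_combination c0 + sa + q00 + q01
          · linear_combination c0 - sb + 2 * sa - hL + q01 - q12 + q00
          · linear_combination sa - q12 - hL
    · rw [thetaSum, Fintype.sum_sum_type, Fin.sum_univ_two, q00, q01, ← hL,
        hcancel c0, add_zero] at h0
      exact h0

end Poke

/-! ### The cocycle condition for `θ_p` -/

section Cocycle

variable {p : ℕ} [Fact p.Prime]

/-- With an integer quotient of the numerator by `p` at hand, identities between values of `θ_p` can
be proved in the integers before reduction. -/
theorem exists_thetaVal_intCast (a b c : ℤ) :
    ∃ m : ℤ, thetaNum p a b c = p * m ∧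
      thetaVal p (a : ZMod p) b c = (((a - b) * m : ℤ) : ZMod p) := by
  obtain ⟨m, hm⟩ := dvd_thetaNum p a b c
  have hp : (p : ℤ) ≠ 0 := by exact_mod_cast (Fact.out : p.Prime).ne_zero
  have : NeZero p := ⟨(Fact.out : p.Prime).ne_zero⟩
  refine ⟨m, hm, ?_⟩
  rw [thetaVal_eq, hm, Int.mul_ediv_cancel_left _ hp]
  push_cast
  rfl

/-- `θ_p` is a cocycle: the sum over the three crossings of a triangle before and after a third
Reidemeister move, the crossing of the two lower strands being at an odd corner of the triangle. -/
theorem thetaVal_triangle_odd (z a b c : ZMod p) :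
    -thetaVal p z a b + thetaVal p z c b - thetaVal p z c a =
      -thetaVal p c (z + a - c) (z + b - c) + thetaVal p a (z + a - c) (z + b - a) -
        thetaVal p b (z + b - c) (z + b - a) := by
  obtain ⟨z, rfl⟩ := ZMod.intCast_surjective z
  obtain ⟨a, rfl⟩ := ZMod.intCast_surjective a
  obtain ⟨b, rfl⟩ := ZMod.intCast_surjective b
  obtain ⟨c, rfl⟩ := ZMod.intCast_surjective c
  obtain ⟨m1, h1, e1⟩ := exists_thetaVal_intCast (p := p) z a b
  obtain ⟨m2, h2, e2⟩ := exists_thetaVal_intCast (p := p) z c b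
  obtain ⟨m3, h3, e3⟩ := exists_thetaVal_intCast (p := p) z c a
  obtain ⟨m4, h4, e4⟩ := exists_thetaVal_intCast (p := p) c (z + a - c) (z + b - c)
  obtain ⟨m5, h5, e5⟩ := exists_thetaVal_intCast (p := p) a (z + a - c) (z + b - a)
  obtain ⟨m6, h6, e6⟩ := exists_thetaVal_intCast (p := p) b (z + b - c) (z + b - a)
  have hp : (p : ℤ) ≠ 0 := by exact_mod_cast (Fact.out : p.Prime).ne_zero
  -- Multiplied by `p`, this is an identity between numerators. It is formal: once the bases are
  -- normalized, the `p`-th powers cancel without being expanded.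
  have key : -((z - a) * m1) + (z - c) * m2 - (z - c) * m3 =
      -((c - (z + a - c)) * m4) + (a - (z + a - c)) * m5 - (b - (z + b - c)) * m6 := by
    apply mul_left_cancel₀ hp
    have : -((z - a) * (p * m1)) + (z - c) * (p * m2) - (z - c) * (p * m3) =
      -((c - (z + a - c)) * (p * m4)) + (a - (z + a - c)) * (p * m5) -
        (b - (z + b - c)) * (p * m6) := by
      rw [← h1, ← h2, ← h3, ← h4, ← h5, ← h6]
      simp only [thetaNum]
      ring_nf
    linear_combination this
  push_cast at e1 e2 e3 e4 e5 e6
  have key' := congrArg (Int.cast : ℤ → ZMod p) key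
  push_cast at key'
  rw [e1, e2, e3, e4, e5, e6, key']

/-- The same, the crossing of the two lower strands being at an even corner of the triangle. -/
theorem thetaVal_triangle_even (z a b c : ZMod p) :
    -thetaVal p z a b + thetaVal p z c b + thetaVal p z a c =
      -thetaVal p c (z + c - a) (z + b - c) + thetaVal p a (z + c - a) (z + b - a) +
        thetaVal p b (z + b - a) (z + b - c) := by
  obtain ⟨z, rfl⟩ := ZMod.intCast_surjective z
  obtain ⟨a, rfl⟩ := ZMod.intCast_surjective a
  obtain ⟨b, rfl⟩ := ZMod.intCast_surjective b
  obtain ⟨c, rfl⟩ := ZMod.intCast_surjective c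
  obtain ⟨m1, h1, e1⟩ := exists_thetaVal_intCast (p := p) z a b
  obtain ⟨m2, h2, e2⟩ := exists_thetaVal_intCast (p := p) z c b
  obtain ⟨m3, h3, e3⟩ := exists_thetaVal_intCast (p := p) z a c
  obtain ⟨m4, h4, e4⟩ := exists_thetaVal_intCast (p := p) c (z + c - a) (z + b - c)
  obtain ⟨m5, h5, e5⟩ := exists_thetaVal_intCast (p := p) a (z + c - a) (z + b - a)
  obtain ⟨m6, h6, e6⟩ := exists_thetaVal_intCast (p := p) b (z + b - a) (z + b - c)
  have hp : (p : ℤ) ≠ 0 := by exact_mod_cast (Fact.out : p.Prime).ne_zero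
  have key : -((z - a) * m1) + (z - c) * m2 + (z - a) * m3 =
      -((c - (z + c - a)) * m4) + (a - (z + c - a)) * m5 + (b - (z + b - a)) * m6 := by
    apply mul_left_cancel₀ hp
    have : -((z - a) * (p * m1)) + (z - c) * (p * m2) + (z - a) * (p * m3) =
      -((c - (z + c - a)) * (p * m4)) + (a - (z + c - a)) * (p * m5) +
        (b - (z + b - a)) * (p * m6) := by
      rw [← h1, ← h2, ← h3, ← h4, ← h5, ← h6]
      simp only [thetaNum]
      ring_nf
    linear_combination this
  push_cast at e1 e2 e3 e4 e5 e6
  have key' := congrArg (Int.cast : ℤ → ZMod p) key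
  push_cast at key'
  rw [e1, e2, e3, e4, e5, e6, key']

end Cocycle

/-! ### The third Reidemeister move -/

section Triangle

/-- The combinatorics of a third Reidemeister move from the gluing `g` to the gluing `g'`: there is
a triangle with the corners `t 0, t 1, t 2`, the strand of its side from `t 0` to `t 1` is over the
two others, and the darts of the triangle change places by `σ`. -/
structure IsTriangleMove {V : Type*} (g g' : V × ZMod 4 → V × ZMod 4) (t : Fin 3 → V × ZMod 4)
    (σ : V × ZMod 4 → V × ZMod 4) : Prop where
  inj : Function.Injective fun i => (t i).1
  side : ∀ i, g (t i) = turn (t (i + 1)) 1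
  side' : ∀ i, g (turn (t (i + 1)) 1) = t i
  odd_zero : (t 0).2 = 1 ∨ (t 0).2 = 3
  even_one : (t 1).2 = 0 ∨ (t 1).2 = 2
  swap0 : ∀ i, σ (t i) = turn (t (i + 1)) 3
  swap1 : ∀ i, σ (turn (t i) 1) = turn (t (i + 2)) 2
  swap2 : ∀ i, σ (turn (t i) 2) = turn (t (i + 1)) 1
  swap3 : ∀ i, σ (turn (t i) 3) = t (i + 2)
  swap_other : ∀ d, (∀ i, (t i).1 ≠ d.1) → σ d = d
  glue_swap : ∀ d, g' (σ d) = σ (g d)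

theorem Fin.three_add (i : Fin 3) : i + 1 + 1 = i + 2 ∧ i + 2 + 1 = i ∧ i + 1 + 2 = i ∧
    i + 2 + 2 = i + 1 := by
  revert i; decide

namespace IsTriangleMove

variable {V : Type*} {g g' : V × ZMod 4 → V × ZMod 4} {t : Fin 3 → V × ZMod 4}
  {σ : V × ZMod 4 → V × ZMod 4}

theorem dart_cases (t : Fin 3 → V × ZMod 4) (d : V × ZMod 4) :
    (∀ i, (t i).1 ≠ d.1) ∨
      ∃ i, d = t i ∨ d = turn (t i) 1 ∨ d = turn (t i) 2 ∨ d = turn (t i) 3 := by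
  by_cases h : ∀ i, (t i).1 ≠ d.1
  · exact Or.inl h
  · right
    push Not at h
    obtain ⟨i, hi⟩ := h
    obtain ⟨v, j⟩ := d
    dsimp only at hi
    subst hi
    obtain ⟨k, rfl⟩ : ∃ k, j = (t i).2 + k := ⟨j - (t i).2, by ring⟩
    refine ⟨i, ?_⟩
    rcases ZMod.four_cases k with rfl | rfl | rfl | rfl
    · left; rw [add_zero]
    · right; left; rfl
    · right; right; left; rfl
    · right; right; right; rfl

theorem swap_swap (h : IsTriangleMove g g' t σ) (d : V × ZMod 4) : σ (σ d) = d := by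
  rcases dart_cases t d with hd | ⟨i, rfl | rfl | rfl | rfl⟩
  · rw [h.swap_other d hd, h.swap_other d hd]
  · rw [h.swap0, h.swap3, (Fin.three_add i).2.2.1]
  · rw [h.swap1, h.swap2, (Fin.three_add i).2.1]
  · rw [h.swap2, h.swap1, (Fin.three_add i).2.2.1]
  · rw [h.swap3, h.swap0, (Fin.three_add i).2.1]

/-- The new triangle occupies the opposite corners at the same three crossings, and a half turn
keeps the parity of a corner. So each later statement is needed in one direction only. -/
theorem symm (h : IsTriangleMove g g' t σ) : IsTriangleMove g' g (fun i => turn (t i) 2) σ where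
  inj := h.inj
  side i := by
    rw [← h.swap_swap (turn (t i) 2), h.swap2, h.glue_swap, h.side', h.swap0, turn_turn]
    rfl
  side' i := by
    have : turn (turn (t (i + 1)) 2) 1 = turn (t (i + 1)) 3 := turn_turn _ _ _
    rw [this, ← h.swap_swap (turn (t (i + 1)) 3), h.swap3, (Fin.three_add i).2.2.1, h.glue_swap,
      h.side, h.swap1, (Fin.three_add i).2.2.1]
  odd_zero := by
    rcases h.odd_zero with h | h <;> simp only [h] <;> decide
  even_one := by
    rcases h.even_one with h | h <;> simp only [h] <;> decide
  swap0 i := by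
    rw [h.swap2, turn_turn]; rfl
  swap1 i := by
    have : turn (turn (t i) 2) 1 = turn (t i) 3 := turn_turn _ _ _
    rw [this, h.swap3, turn_turn]
    exact (turn_zero _).symm
  swap2 i := by
    have : turn (turn (t i) 2) 2 = turn (t i) 0 := turn_turn _ _ _
    rw [this, turn_zero, h.swap0, turn_turn]; rfl
  swap3 i := by
    have : turn (turn (t i) 2) 3 = turn (t i) 1 := turn_turn _ _ _
    rw [this, h.swap1]
  swap_other d hd := h.swap_other d hd
  glue_swap d := by
    have := h.glue_swap (σ d)
    rw [h.swap_swap] at this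
    rw [this, h.swap_swap]

variable {p : ℕ}

/-- The colors of the four corners at a vertex of the triangle after the move. -/
def newColor (F : V × ZMod 4 → ZMod p) (t : Fin 3 → V × ZMod 4) (i : Fin 3) (s : ZMod 4) : ZMod p :=
  -- The six outer regions persist, but meet other crossings of the triangle. The remaining corner,
  -- `s = 2`, belongs to the new triangle, and its color is forced by the condition at `t 0`.
  if s = 0 then F (turn (t (i + 2)) 1) else if s = 1 then F (turn (t (i + 2)) 2) else
    if s = 3 then F (turn (t (i + 1)) 2) else
      F (turn (t 2) 1) + F (turn (t 1) 2) - F (turn (t 2) 2)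

open Classical in
/-- The coloring after the move. -/
noncomputable def newColoring (F : V × ZMod 4 → ZMod p) (t : Fin 3 → V × ZMod 4)
    (d : V × ZMod 4) : ZMod p :=
  if h : ∃ i, (t i).1 = d.1 then newColor F t h.choose (d.2 - (t h.choose).2) else F d

theorem newColoring_turn (h : Function.Injective fun i => (t i).1) (F : V × ZMod 4 → ZMod p)
    (i : Fin 3) (s : ZMod 4) : newColoring F t (turn (t i) s) = newColor F t i s := by
  have hex : ∃ j, (t j).1 = (turn (t i) s).1 := ⟨i, rfl⟩
  have hc : hex.choose = i := h hex.choose_spec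
  rw [newColoring, dif_pos hex, hc, turn, add_sub_cancel_left]

theorem newColoring_other (F : V × ZMod 4 → ZMod p) {d : V × ZMod 4}
    (hd : ∀ i, (t i).1 ≠ d.1) : newColoring F t d = F d := by
  rw [newColoring, dif_neg]
  rintro ⟨i, hi⟩
  exact hd i hi

variable {F : V × ZMod 4 → ZMod p}

/-- The corners `t i` lie in one region, the triangle. The two corners in the second part lie in the
region across the side from `t i` to `t (i + 1)`. -/
theorem colors (h : IsTriangleMove g g' t σ) (hF : IsCornerColoring g F) (i : Fin 3) :
    F (t i) = F (t 0) ∧ F (turn (t i) 3) = F (turn (t (i + 1)) 1) := by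
  have h1 : ∀ i, F (t (i + 1)) = F (t i) := by
    intro i
    have := hF.face (t i)
    rw [h.side, turn_turn] at this
    rw [← this]
    exact congrArg F (turn_zero _).symm
  have h2 : ∀ i, F (turn (t i) 3) = F (turn (t (i + 1)) 1) := by
    intro i
    have := hF.face (turn (t (i + 1)) 1)
    rwa [h.side'] at this
  refine ⟨?_, h2 i⟩
  have e1 : F (t 1) = F (t 0) := h1 0
  have e2 : F (t 2) = F (t 1) := h1 1
  have hi : i = 0 ∨ i = 1 ∨ i = 2 := by revert i; decide
  rcases hi with rfl | rfl | rfl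
  · rfl
  · exact e1
  · exact e2.trans e1

/-- The sides of a dart keep their colors when the dart moves, if it is not in the triangle. -/
theorem newColoring_swap (h : IsTriangleMove g g' t σ) (hF : IsCornerColoring g F)
    {d : V × ZMod 4} (hd : ∀ i, d ≠ t i ∧ d ≠ turn (t i) 1) :
    newColoring F t (σ d) = F d ∧ newColoring F t (turn (σ d) (-1)) = F (turn d (-1)) := by
  rcases dart_cases t d with hd' | ⟨i, rfl | rfl | rfl | rfl⟩
  · rw [h.swap_other d hd']
    exact ⟨newColoring_other F hd', newColoring_other F hd'⟩
  · exact absurd rfl (hd i).1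
  · exact absurd rfl (hd i).2
  · obtain ⟨a1, a2, a3, a4⟩ := Fin.three_add i
    rw [h.swap2, turn_turn, turn_turn, newColoring_turn h.inj, newColoring_turn h.inj]
    change F (turn (t (i + 1 + 2)) 2) = _ ∧ F (turn (t (i + 1 + 2)) 1) = _
    rw [a3]
    exact ⟨rfl, rfl⟩
  · obtain ⟨a1, a2, a3, a4⟩ := Fin.three_add i
    rw [h.swap3, turn_turn, newColoring_turn h.inj, ← turn_zero (t (i + 2)),
      newColoring_turn h.inj]
    change F (turn (t (i + 2 + 2)) 1) = _ ∧ F (turn (t (i + 2 + 1)) 2) = _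
    rw [a4, a2, (h.colors hF i).2]
    exact ⟨rfl, rfl⟩

/-- A semi-arc that is not a side of the triangle keeps the colors at both of its sides, so the old
condition applies. The three sides are computed directly. -/
theorem newColoring_face (h : IsTriangleMove g g' t σ) (hF : IsCornerColoring g F)
    (hg : ∀ d, g (g d) = d) (d : V × ZMod 4) :
    newColoring F t (turn (g' d) (-1)) = newColoring F t d := by
  obtain ⟨d, rfl⟩ : ∃ e, d = σ e := ⟨σ d, (h.swap_swap d).symm⟩
  rw [h.glue_swap]
  by_cases hd : ∀ i, d ≠ t i ∧ d ≠ turn (t i) 1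
  · have hgd : ∀ i, g d ≠ t i ∧ g d ≠ turn (t i) 1 := by
      intro i
      constructor
      · intro e
        apply (hd (i + 1)).2
        rw [← hg d, e, h.side]
      · intro e
        apply (hd (i + 2)).1
        have := h.side' (i + 2)
        rw [(Fin.three_add i).2.1] at this
        rw [← hg d, e, this]
    rw [(h.newColoring_swap hF hgd).2, (h.newColoring_swap hF hd).1, hF.face]
  · have hd' : ∃ i, d = t i ∨ d = turn (t (i + 1)) 1 := by
      push Not at hd
      obtain ⟨i, hi⟩ := hd
      by_cases e : d = t i
      · exact ⟨i, Or.inl e⟩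
      · refine ⟨i + 2, Or.inr ?_⟩
        rw [(Fin.three_add i).2.1]
        exact hi e
    obtain ⟨i, rfl | rfl⟩ := hd'
    · obtain ⟨a1, a2, a3, a4⟩ := Fin.three_add i
      rw [h.side, h.swap1, h.swap0, a3, turn_turn, newColoring_turn h.inj, newColoring_turn h.inj]
      change F (turn (t (i + 2)) 2) = F (turn (t (i + 1 + 1)) 2)
      rw [a1]
    · obtain ⟨a1, a2, a3, a4⟩ := Fin.three_add i
      rw [h.side', h.swap0, h.swap1, a3, turn_turn, newColoring_turn h.inj, newColoring_turn h.inj]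
      rfl

/-- The color of the triangle and those of the three regions across its sides determine the other
three. The position of the over-strand fixes the parities at `t 0` and `t 1`, so only that of `t 2`
gives two cases. -/
theorem crossings (h : IsTriangleMove g g' t σ) (hF : IsCornerColoring g F) :
    F (turn (t 0) 2) = F (t 0) + F (turn (t 1) 1) - F (turn (t 0) 1) ∧
    F (turn (t 1) 2) = F (t 0) + F (turn (t 1) 1) - F (turn (t 2) 1) ∧
    (((t 2).2 = 1 ∨ (t 2).2 = 3) ∧
        F (turn (t 2) 2) = F (t 0) + F (turn (t 0) 1) - F (turn (t 2) 1) ∨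
      ((t 2).2 = 0 ∨ (t 2).2 = 2) ∧
        F (turn (t 2) 2) = F (t 0) + F (turn (t 2) 1) - F (turn (t 0) 1)) := by
  have c0 := (crossing_iff_of_odd h.odd_zero).1 (hF.crossing _)
  have c1 := (crossing_iff_of_even h.even_one).1 (hF.crossing _)
  have r0 : F (turn (t 0) 3) = F (turn (t 1) 1) := (h.colors hF 0).2
  have r1 : F (turn (t 1) 3) = F (turn (t 2) 1) := (h.colors hF 1).2
  have r2 : F (turn (t 2) 3) = F (turn (t 0) 1) := (h.colors hF 2).2
  have z1 := (h.colors hF 1).1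
  have z2 := (h.colors hF 2).1
  refine ⟨by linear_combination r0 - c0, by linear_combination z1 - c1 - r1, ?_⟩
  have hk : ((t 2).2 = 1 ∨ (t 2).2 = 3) ∨ ((t 2).2 = 0 ∨ (t 2).2 = 2) := by
    have := ZMod.four_cases (t 2).2
    tauto
  rcases hk with hk | hk
  · have c2 := (crossing_iff_of_odd hk).1 (hF.crossing _)
    exact Or.inl ⟨hk, by linear_combination r2 + z2 - c2⟩
  · have c2 := (crossing_iff_of_even hk).1 (hF.crossing _)
    exact Or.inr ⟨hk, by linear_combination z2 - c2 - r2⟩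

theorem newColoring_at (h : IsTriangleMove g g' t σ) (F : V × ZMod 4 → ZMod p) (i : Fin 3) :
    newColoring F t (t i) = F (turn (t (i + 2)) 1) ∧
    newColoring F t (turn (t i) 1) = F (turn (t (i + 2)) 2) ∧
    newColoring F t (turn (t i) 2) = F (turn (t 2) 1) + F (turn (t 1) 2) - F (turn (t 2) 2) ∧
    newColoring F t (turn (t i) 3) = F (turn (t (i + 1)) 2) := by
  refine ⟨?_, newColoring_turn h.inj F i 1, newColoring_turn h.inj F i 2,
    newColoring_turn h.inj F i 3⟩
  rw [← turn_zero (t i), newColoring_turn h.inj]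
  rfl

/-- At `t 0` the condition holds by the choice of the color of the new triangle; at `t 1` and `t 2`
it follows from the three old conditions. -/
theorem isCornerColoring (h : IsTriangleMove g g' t σ) (hF : IsCornerColoring g F)
    (hg : ∀ d, g (g d) = d) : IsCornerColoring g' (newColoring F t) := by
  refine ⟨h.newColoring_face hF hg, fun v => ?_⟩
  by_cases hv : ∀ i, (t i).1 ≠ v
  · rw [newColoring_other F hv, newColoring_other F hv, newColoring_other F hv,
      newColoring_other F hv]
    exact hF.crossing v
  · push Not at hv
    obtain ⟨i, rfl⟩ := hv
    obtain ⟨q0, q1, q2⟩ := h.crossings hF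
    have hi : i = 0 ∨ i = 1 ∨ i = 2 := by revert i; decide
    rcases hi with rfl | rfl | rfl
    · obtain ⟨n0, n1, n2, n3⟩ := h.newColoring_at F 0
      rw [crossing_iff_of_odd h.odd_zero, n0, n1, n2, n3]
      change F (turn (t 2) 1) + F (turn (t 1) 2) = F (turn (t 2) 2) + _
      ring
    · obtain ⟨n0, n1, n2, n3⟩ := h.newColoring_at F 1
      rw [crossing_iff_of_even h.even_one, n0, n1, n2, n3]
      change F (turn (t 0) 1) + F (turn (t 0) 2) = _ + F (turn (t 2) 2)
      linear_combination q0 - q1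
    · obtain ⟨n0, n1, n2, n3⟩ := h.newColoring_at F 2
      rcases q2 with ⟨hk, q2⟩ | ⟨hk, q2⟩
      · rw [crossing_iff_of_odd hk, n0, n1, n2, n3]
        change F (turn (t 1) 1) + F (turn (t 0) 2) = F (turn (t 1) 2) + _
        linear_combination q0 - 2 * q1 + q2
      · rw [crossing_iff_of_even hk, n0, n1, n2, n3]
        change F (turn (t 1) 1) + F (turn (t 1) 2) = _ + F (turn (t 0) 2)
        linear_combination q2 - q0

/-- Semi-arcs other than the sides of the triangle keep their Fox colors. At each crossing of the
triangle the two outer darts then have the Fox color `s`, which with the coloring condition makes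
opposite corners equal; so the sides have the Fox color `s` too. -/
theorem isFoxConstant (h : IsTriangleMove g g' t σ) (hF : IsCornerColoring g F)
    (hc : IsFoxConstant (newColoring F t)) : IsFoxConstant F := by
  obtain ⟨s, hs⟩ := hc
  have hext : ∀ d, (∀ i, d ≠ t i ∧ d ≠ turn (t i) 1) → F d + F (turn d (-1)) = s := by
    intro d hd
    have := hs (σ d)
    rwa [(h.newColoring_swap hF hd).1, (h.newColoring_swap hF hd).2] at this
  have hne : ∀ i, (∀ j, turn (t i) 2 ≠ t j ∧ turn (t i) 2 ≠ turn (t j) 1) ∧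
      ∀ j, turn (t i) 3 ≠ t j ∧ turn (t i) 3 ≠ turn (t j) 1 := by
    have key : ∀ i j (a b : ZMod 4), turn (t i) a = turn (t j) b → a = b := by
      intro i j a b e
      have e1 : (t i).1 = (t j).1 := (Prod.ext_iff.1 e).1
      obtain rfl : i = j := h.inj e1
      exact add_left_cancel (Prod.ext_iff.1 e).2
    have key' : ∀ i j (a : ZMod 4), turn (t i) a = t j → a = 0 := by
      intro i j a e
      rw [← turn_zero (t j)] at e
      exact key _ _ _ _ e
    intro i
    refine ⟨fun j => ⟨fun e => ?_, fun e => ?_⟩, fun j => ⟨fun e => ?_, fun e => ?_⟩⟩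
    · exact absurd (key' _ _ _ e) (by decide)
    · exact absurd (key _ _ _ _ e) (by decide)
    · exact absurd (key' _ _ _ e) (by decide)
    · exact absurd (key _ _ _ _ e) (by decide)
  have f2 : ∀ i, F (turn (t i) 2) + F (turn (t i) 1) = s := by
    intro i
    have := hext _ (hne i).1
    rw [turn_turn] at this
    exact this
  have f3 : ∀ i, F (turn (t i) 3) + F (turn (t i) 2) = s := by
    intro i
    have := hext _ (hne i).2
    rw [turn_turn] at this
    exact this
  have e31 : ∀ i, F (turn (t i) 3) = F (turn (t i) 1) := fun i => by
    linear_combination f3 i - f2 i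
  have e20 : ∀ i, F (turn (t i) 2) = F (t i) := by
    intro i
    have hk : ((t i).2 = 1 ∨ (t i).2 = 3) ∨ ((t i).2 = 0 ∨ (t i).2 = 2) := by
      have := ZMod.four_cases (t i).2
      tauto
    rcases hk with hk | hk
    · have c := (crossing_iff_of_odd hk).1 (hF.crossing _)
      linear_combination e31 i - c
    · have c := (crossing_iff_of_even hk).1 (hF.crossing _)
      linear_combination -e31 i - c
  refine ⟨s, fun d => ?_⟩
  by_cases hd : ∀ i, d ≠ t i ∧ d ≠ turn (t i) 1
  · exact hext d hd
  · push Not at hd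
    obtain ⟨i, hi⟩ := hd
    by_cases e : d = t i
    · subst e
      change F (t i) + F (turn (t i) 3) = s
      linear_combination f3 i - e20 i
    · rw [hi e, turn_turn]
      have : F (turn (t i) (1 + -1)) = F (t i) := congrArg F (turn_zero _)
      rw [this]
      linear_combination f2 i - e20 i

variable [Fintype V] [Fact p.Prime]

/-- Crossings off the triangle contribute the same before and after. For the other three this is the
cocycle condition, `z` being the color of the triangle and `a, b, c` those across its sides. -/
theorem thetaSum_eq (h : IsTriangleMove g g' t σ) (hF : IsCornerColoring g F)
    (hg : ∀ d, g (g d) = d) : thetaSum (newColoring F t) = thetaSum F := by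
  classical
  have hF' := h.isCornerColoring hF hg
  have hsplit : ∀ f : V → ZMod p, ∑ v, f v =
      (f (t 0).1 + f (t 1).1 + f (t 2).1) +
        ∑ v ∈ (Finset.univ.image fun i => (t i).1)ᶜ, f v := by
    intro f
    rw [← Finset.sum_add_sum_compl (Finset.univ.image fun i => (t i).1),
      Finset.sum_image fun i _ j _ e => h.inj e, Fin.sum_univ_three]
  rw [thetaSum, thetaSum, hsplit, hsplit]
  congr 1
  · obtain ⟨q0, q1, q2⟩ := h.crossings hF
    have r0 : F (turn (t 0) 3) = F (turn (t 1) 1) := (h.colors hF 0).2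
    have r1 : F (turn (t 1) 3) = F (turn (t 2) 1) := (h.colors hF 1).2
    have r2 : F (turn (t 2) 3) = F (turn (t 0) 1) := (h.colors hF 2).2
    have z1 := (h.colors hF 1).1
    have z2 := (h.colors hF 2).1
    obtain ⟨l0, l1, l2, l3⟩ := h.newColoring_at F 0
    obtain ⟨m0, m1, m2, m3⟩ := h.newColoring_at F 1
    obtain ⟨n0, n1, n2, n3⟩ := h.newColoring_at F 2
    change _ = F (turn (t 2) 1) at l0
    change _ = F (turn (t 2) 2) at l1
    change _ = F (turn (t 1) 2) at l3
    change _ = F (turn (t 0) 1) at m0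
    change _ = F (turn (t 0) 2) at m1
    change _ = F (turn (t 2) 2) at m3
    change _ = F (turn (t 1) 1) at n0
    change _ = F (turn (t 1) 2) at n1
    change _ = F (turn (t 0) 2) at n3
    rw [thetaVal_of_odd h.odd_zero (hF.crossing _), thetaVal_of_odd h.odd_zero (hF'.crossing _),
      thetaVal_of_even h.even_one (hF.crossing _), thetaVal_of_even h.even_one (hF'.crossing _),
      r0, r1, z1, l0, l1, l3, m0, m1, m3]
    rcases q2 with ⟨hk, q2⟩ | ⟨hk, q2⟩
    · rw [thetaVal_of_odd hk (hF.crossing _), thetaVal_of_odd hk (hF'.crossing _),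
        r2, z2, n0, n1, n3, q0, q1, q2]
      simp only [← sub_eq_add_neg]
      exact (thetaVal_triangle_odd _ _ _ _).symm
    · rw [thetaVal_of_even hk (hF.crossing _), thetaVal_of_even hk (hF'.crossing _),
        r2, z2, n0, n1, n3, q0, q1, q2]
      exact (thetaVal_triangle_even _ _ _ _).symm
  · refine Finset.sum_congr rfl fun v hv => ?_
    have hv' : ∀ i, (t i).1 ≠ v := by
      intro i e
      rw [Finset.mem_compl, Finset.mem_image] at hv
      exact hv ⟨i, Finset.mem_univ _, e⟩
    rw [newColoring_other F hv', newColoring_other F hv', newColoring_other F hv']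

/-- The third Reidemeister move. -/
theorem hasZero (h : IsTriangleMove g g' t σ) (hg : ∀ d, g (g d) = d) (hz : HasZero p g) :
    HasZero p g' := by
  obtain ⟨F, hF, hn, h0⟩ := hz
  exact ⟨newColoring F t, h.isCornerColoring hF hg, fun hc => hn (h.isFoxConstant hF hc),
    (h.thetaSum_eq hF hg).trans h0⟩

end IsTriangleMove

end Triangle

/-! ### Invariance under the moves of diagrams -/

namespace KnotDiagram

variable {D D' : KnotDiagram} {p : ℕ}

theorem Iso.symm (h : Iso D D') : Iso D' D := by
  obtain ⟨f, s, hs, h⟩ := h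
  have hss : ∀ v (k : ZMod 4), k + s v + s v = k := by
    intro v k
    rcases hs v with h | h <;> rw [h] <;> revert k <;> decide
  refine ⟨f.symm, fun v => s (f.symm v), fun v => hs _, ?_⟩
  rintro ⟨v, j⟩ b rfl
  have key := h (f.symm v, j + s (f.symm v)) _ rfl
  simp only [Equiv.apply_symm_apply, hss] at key
  rw [key]
  simp only [Equiv.symm_apply_apply, hss]

theorem Iso.hasZero [NeZero p] (h : Iso D D') (hz : HasZero p D.glue) : HasZero p D'.glue := by
  obtain ⟨f, s, hs, h⟩ := h
  exact hz.of_iso f s hs fun a => h a _ rfl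

theorem R1.hasZero_iff [NeZero p] (h : R1 D D') : HasZero p D.glue ↔ HasZero p D'.glue := by
  obtain ⟨f, d, k, h1, h2, h3, h4⟩ := h
  rw [← hasZero_pullGlue f]
  exact hasZero_kink D.glue_glue (pullGlue_pullGlue D'.glue_glue) (d := d) (k := k)
    (pullGlue_eq h1) (pullGlue_eq h2) (pullGlue_eq h3) fun a ha ha' => pullGlue_eq (h4 a ha ha')

theorem R2.hasZero_iff [NeZero p] (h : R2 D D') : HasZero p D.glue ↔ HasZero p D'.glue := by
  obtain ⟨f, a, b, hab, -, -, h1, h2, h3, h4, h5, h6, h7⟩ := h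
  rw [← hasZero_pullGlue f]
  refine hasZero_poke D.glue_glue (pullGlue_pullGlue D'.glue_glue) (a := a) (b := b) ?_
    (pullGlue_eq h1) (pullGlue_eq h2) (pullGlue_eq h3) (pullGlue_eq h4) (pullGlue_eq h5)
    (pullGlue_eq h6) fun c c1 c2 c3 c4 => pullGlue_eq (h7 c c1 c2 c3 c4)
  intro F hF
  obtain ⟨C, hC⟩ := D.exists_regionOf_comp F hF.face
  rw [← hC, ← hC, hab]

theorem Fin.three_cases (i : Fin 3) : i = 0 ∨ i = 1 ∨ i = 2 := by
  revert i; decide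

theorem face_eq_iff {a b : Dart D.n} : D.face a = b ↔ D.glue a = turn b 1 := by
  change turn (D.glue a) (-1) = b ↔ _
  constructor
  · rintro rfl
    rw [turn_turn]
    exact (turn_zero _).symm
  · intro h
    rw [h, turn_turn]
    exact turn_zero _

theorem R3.isTriangleMove (h : R3 D D') : ∃ (f : Fin D.n ≃ Fin D'.n) (t : Fin 3 → Dart D.n)
    (σ : Dart D.n → Dart D.n), IsTriangleMove D.glue (pullGlue f D'.glue) t σ := by
  obtain ⟨c, hc, n1, n2, n3, ho, hu, f, hf⟩ := h
  let t : Fin 3 → Dart D.n := ![c, D.face c, D.face (D.face c)]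
  have ht : ∀ i, D.face (t i) = t (i + 1) := by
    intro i
    rcases Fin.three_cases i with rfl | rfl | rfl
    · rfl
    · rfl
    · exact hc
  have inj : Function.Injective fun i => (t i).1 := by
    intro i j hij
    rcases Fin.three_cases i with rfl | rfl | rfl <;> rcases Fin.three_cases j with rfl | rfl | rfl
    · rfl
    · exact absurd hij n1
    · exact absurd hij n2
    · exact absurd hij.symm n1
    · rfl
    · exact absurd hij n3
    · exact absurd hij.symm n2
    · exact absurd hij.symm n3
    · rfl
  have side : ∀ i, D.glue (t i) = turn (t (i + 1)) 1 := fun i => face_eq_iff.1 (ht i)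
  have side' : ∀ i, D.glue (turn (t (i + 1)) 1) = t i := fun i => by rw [← side, D.glue_glue]
  have hside : ∀ d, D.IsSide c d ↔ ∃ i, d = t i ∨ d = turn (t i) 1 := by
    intro d
    constructor
    · rintro ((h | h | h) | (h | h | h))
      · exact ⟨0, Or.inl h⟩
      · exact ⟨1, Or.inl h⟩
      · exact ⟨2, Or.inl h⟩
      · exact ⟨0, Or.inr h⟩
      · exact ⟨1, Or.inr h⟩
      · exact ⟨2, Or.inr h⟩
    · rintro ⟨i, h⟩
      rcases Fin.three_cases i with rfl | rfl | rfl
      · exact h.imp Or.inl Or.inl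
      · exact h.imp (Or.inr ∘ Or.inl) (Or.inr ∘ Or.inl)
      · exact h.imp (Or.inr ∘ Or.inr) (Or.inr ∘ Or.inr)
  have key : ∀ i j (a b : ZMod 4), turn (t i) a = turn (t j) b → a = b := by
    intro i j a b e
    obtain rfl : i = j := inj (Prod.ext_iff.1 e).1
    exact add_left_cancel (Prod.ext_iff.1 e).2
  have hside_turn : ∀ i a, D.IsSide c (turn (t i) a) ↔ a = 0 ∨ a = 1 := by
    intro i a
    rw [hside]
    constructor
    · rintro ⟨j, h | h⟩
      · rw [← turn_zero (t j)] at h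
        exact Or.inl (key _ _ _ _ h)
      · exact Or.inr (key _ _ _ _ h)
    · rintro (rfl | rfl)
      · exact ⟨i, Or.inl (turn_zero _)⟩
      · exact ⟨i, Or.inr rfl⟩
  have swap_side : ∀ i a, a = 0 ∨ a = 1 →
      D.triangleSwap c (turn (t i) a) = turn (D.glue (turn (t i) a)) 2 := by
    intro i a ha
    rw [triangleSwap, if_pos ((hside_turn i a).2 ha)]
    rfl
  have swap_far : ∀ i a, a = 2 ∨ a = 3 →
      D.triangleSwap c (turn (t i) a) = D.glue (turn (t i) (a + 2)) := by
    intro i a ha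
    have e : Dart.rot (turn (t i) a) 2 = turn (t i) (a + 2) := turn_turn _ _ _
    rw [triangleSwap, e, if_neg, if_pos]
    · rw [hside_turn]
      rcases ha with rfl | rfl
      · left; rfl
      · right; rfl
    · rw [hside_turn]
      rcases ha with rfl | rfl <;> decide
  have side'' : ∀ i, D.glue (turn (t i) 1) = t (i + 2) := by
    intro i
    have := side' (i + 2)
    rwa [(Fin.three_add i).2.1] at this
  refine ⟨f, t, D.triangleSwap c, inj, side, side', ho, ?_, fun i => ?_, fun i => ?_, fun i => ?_,
    fun i => ?_, fun d hd => ?_, fun d => pullGlue_eq (hf d _ rfl)⟩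
  -- The over-strand arrives at its second crossing by the dart `turn (t 1) 1`; so the dart `t 1`
  -- itself is under.
  · have h1 : D.glue c = turn (t 1) 1 := side 0
    rw [h1] at hu
    have h2 : (t 1).2 + 1 = 1 ∨ (t 1).2 + 1 = 3 := hu
    have : ∀ k : ZMod 4, k + 1 = 1 ∨ k + 1 = 3 → k = 0 ∨ k = 2 := by decide
    exact this _ h2
  · have := swap_side i 0 (Or.inl rfl)
    rw [turn_zero, side, turn_turn] at this
    exact this
  · have := swap_side i 1 (Or.inr rfl)
    rwa [side''] at this
  · have := swap_far i 2 (Or.inl rfl)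
    rw [this, ← side]
    exact congrArg D.glue (turn_zero (t i))
  · have := swap_far i 3 (Or.inr rfl)
    rw [this, ← side'']
    rfl
  · rw [triangleSwap, if_neg, if_neg]
    · rw [hside]
      rintro ⟨i, h | h⟩
      · exact hd i (Prod.ext_iff.1 h).1.symm
      · exact hd i (Prod.ext_iff.1 h).1.symm
    · rw [hside]
      rintro ⟨i, h | h⟩
      · exact hd i (Prod.ext_iff.1 h).1.symm
      · exact hd i (Prod.ext_iff.1 h).1.symm

theorem R3.hasZero_iff [Fact p.Prime] (h : R3 D D') : HasZero p D.glue ↔ HasZero p D'.glue := by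
  have : NeZero p := ⟨(Fact.out : p.Prime).ne_zero⟩
  obtain ⟨f, t, σ, h⟩ := h.isTriangleMove
  rw [← hasZero_pullGlue f]
  exact ⟨h.hasZero D.glue_glue, h.symm.hasZero (pullGlue_pullGlue D'.glue_glue)⟩

theorem Step.hasZero_iff [Fact p.Prime] (h : Step D D') :
    HasZero p D.glue ↔ HasZero p D'.glue := by
  have : NeZero p := ⟨(Fact.out : p.Prime).ne_zero⟩
  rcases h with h | h | h | h
  · exact ⟨h.hasZero, h.symm.hasZero⟩
  · exact h.hasZero_iff
  · exact h.hasZero_iff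
  · exact h.hasZero_iff

end KnotDiagram

/-- Whether `θ_p` vanishes on some nontrivial coloring does not depend on the diagram. -/
theorem Knot.HasDiagram.hasZero_iff {p : ℕ} [Fact p.Prime] {K : Knot} {D D' : KnotDiagram}
    (hD : K.HasDiagram D) (hD' : K.HasDiagram D') : HasZero p D.glue ↔ HasZero p D'.glue := by
  let φ : Knot → Prop := Quot.lift (fun D => HasZero p D.glue) fun _ _ h => propext h.hasZero_iff
  have h : φ (Quot.mk _ D) = φ (Quot.mk _ D') :=
    congrArg φ (Eq.trans (hD : Quot.mk KnotDiagram.Step D = K) (hD' : Quot.mk _ D' = K).symm)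
  exact iff_of_eq h

/-! ### The search for parity rigid sets -/

namespace RigidSearch

/-- The bit `32 * a + m`, for `a, m < 32`, tells whether `m &&& a` has an even number of binary
digits `1`. -/
def evenTable : ℕ :=
  0x69969669c33c3cc3a55a5aa50ff0f00f9966669933cccc3355aaaa55ff0000ff969669693c3cc3c35a5aa5a5f0f00f0f66669999cccc3333aaaa55550000ffff966996693cc33cc35aa55aa5f00ff00f66996699cc33cc33aa55aa5500ff00ff69696969c3c3c3c3a5a5a5a50f0f0f0f999999993333333355555555ffffffff

/-- `k n`, where the kernel evaluates `n` first. -/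
def force {α : Type} (n : ℕ) (k : ℕ → α) : α :=
  Nat.rec (k 0) (fun m _ => k (Nat.succ m)) n

/-- The entry of `tab` (a table of entries below `64`) at `s`. -/
def entry (tab s : ℕ) : ℕ := Nat.mod (Nat.shiftRight tab (Nat.mul 8 s)) 64

/-- Take note of the sums of `t` with the elements of `T`. The elements carry labels, subsets of
five bits. `tab` stores the symmetric difference of the labels of a first pair with a given sum, and
`V` is the set of those characters of the group of labels that agree on all pairs with the same
sum. -/
def addSums (p t e : ℕ) (T : List (ℕ × ℕ)) : ℕ → ℕ → (ℕ → ℕ → Bool) → Bool :=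
  List.rec (fun tab V k => k tab V) (fun x _ ih tab V k =>
    force (Nat.mod (Nat.add t x.1) p) fun s =>
    -- The bit `32` marks the entry as occupied, since the symmetric difference itself may be `0`.
    force (Nat.lor 32 (Nat.mod (Nat.xor e x.2) 32)) fun r =>
    force (entry tab s) fun old =>
    Bool.rec
      -- An occupied entry: only those characters survive that are trivial on the difference of the
      -- old and the new label.
      (force (Nat.land V (Nat.shiftRight evenTable (Nat.mul 32 (Nat.mod (Nat.xor old r) 32))))
        fun V' => ih tab V' k)
      (force (Nat.lor tab (Nat.shiftLeft r (Nat.mul 8 s))) fun tab' => ih tab' V k)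
      (Nat.beq old 0)) T

/-- `f t` holds for `cnt` successive values of `t`. -/
def loop (f : ℕ → Bool) (cnt : ℕ) : ℕ → Bool :=
  Nat.rec (fun _ => true) (fun _ ih t => Bool.rec false (force (Nat.succ t) ih) (f t)) cnt

/-- There is a nonconstant character in `V`, or `T` is `good`. -/
def check (good : List (ℕ × ℕ) → Bool) (e : ℕ) (T : List (ℕ × ℕ)) (V : ℕ) : Bool :=
  -- The labels in use involve only the bits below `e`, a power of two, so the characters to
  -- consider are `m < e`; the shift by one discards the trivial character `0`.
  Bool.rec true (good T) (Nat.beq (Nat.shiftRight (Nat.mod V (Nat.shiftLeft 1 e)) 1) 0)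

/-- All sets that arise from `T` by adding at most `depth` elements that are at least `lo`, in
increasing order and never skipped, pass the check. -/
def search (p : ℕ) (skip : ℕ → List (ℕ × ℕ) → Bool) (good : List (ℕ × ℕ) → Bool) (depth : ℕ) :
    ℕ → ℕ → List (ℕ × ℕ) → ℕ → ℕ → Bool :=
  Nat.rec (fun _ e T _ V => check good e T V) (fun _ ih lo e T tab V =>
    Bool.rec false (force (Nat.mul 2 e) fun e' =>
      loop (fun t => Bool.rec
        (addSums p t e ((t, e) :: T) tab V fun tab' V' =>
          force (Nat.succ t) fun t' => ih t' e' ((t, e) :: T) tab' V')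
        true (skip t T)) (Nat.sub p lo) lo)
      (check good e T V)) depth

/-- Adding `t` to `T` gives an arithmetic progression of length three. -/
def makesProgression (p t : ℕ) (T : List (ℕ × ℕ)) : Bool :=
  T.any fun x => T.any fun y => Bool.rec
    (Bool.rec (Nat.beq (Nat.mod (Nat.add x.1 y.1) p) (Nat.mod (Nat.mul 2 t) p)) true
      (Nat.beq (Nat.mod (Nat.add t x.1) p) (Nat.mod (Nat.mul 2 y.1) p)))
    false (Nat.beq x.1 y.1)

/-- `T` is mapped into one of the sets `R` by an affine map, with `0 ↦ b` and `1 ↦ c`. -/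
def mapsInto (p : ℕ) (Rs : List (List ℕ)) (T : List (ℕ × ℕ)) : Bool :=
  Rs.any fun R => R.any fun b => R.any fun c => Bool.rec
    -- Adding `p` to `c` avoids truncation in the difference `c - b`.
    (T.all fun x => force (Nat.mod (Nat.add b (Nat.mul (Nat.sub (Nat.add c p) b) x.1)) p) fun y =>
      R.any fun r => Nat.beq r y)
    false (Nat.beq b c)

/-- The search for sets with at most `n + 3` elements that contain `0, 1, 2`. -/
def searchProgression (p : ℕ) (Rs : List (List ℕ)) (n : ℕ) : Bool :=
  -- `4294967295 = 2 ^ 32 - 1` stands for all characters. The label of `0` is `0`, which normalizes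
  -- the functions to vanish there; the other elements get independent labels `1, 2, 4, …`, so five
  -- bits serve sets of six elements.
  addSums p 0 0 [(0, 0)] 0 4294967295 fun tab V =>
  addSums p 1 1 [(1, 1), (0, 0)] tab V fun tab V =>
  addSums p 2 2 [(2, 2), (1, 1), (0, 0)] tab V fun tab V =>
  search p (fun _ _ => false) (mapsInto p Rs) n 3 4 [(2, 2), (1, 1), (0, 0)] tab V

/-- The search for sets with at most `n + 2` elements that contain `0, 1` and no arithmetic
progression of length three. -/
def searchNoProgression (p n : ℕ) : Bool :=
  addSums p 0 0 [(0, 0)] 0 4294967295 fun tab V =>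
  addSums p 1 1 [(1, 1), (0, 0)] tab V fun tab V =>
  search p (makesProgression p) (fun _ => false) n 2 2 [(1, 1), (0, 0)] tab V

/-! ### Soundness of the search -/

theorem force_eq {α : Type} (n : ℕ) (k : ℕ → α) : force n k = k n := by
  cases n <;> rfl

/-- Whether `m &&& a` has an odd number of binary digits `1` among the first five. -/
def odd (m a : ℕ) : Bool :=
  (m.testBit 0 && a.testBit 0) ^^ (m.testBit 1 && a.testBit 1) ^^ (m.testBit 2 && a.testBit 2) ^^
    (m.testBit 3 && a.testBit 3) ^^ (m.testBit 4 && a.testBit 4)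

/-- So each `m` acts as a character of the group of labels. -/
theorem odd_xor (m a b : ℕ) : odd m (a ^^^ b) = (odd m a ^^ odd m b) := by
  simp only [odd, Nat.testBit_xor, Bool.and_xor_distrib_left]
  simp only [Bool.xor_assoc, Bool.xor_left_comm]

theorem odd_lor_mod (m a : ℕ) : odd m (32 ||| a % 32) = odd m a := by
  have h : ∀ i < 5, (32 ||| a % 32).testBit i = a.testBit i := by
    intro i hi
    have h32 : Nat.testBit 32 i = false := by
      interval_cases i <;> rfl
    rw [Nat.testBit_or, h32, Bool.false_or, show (32 : ℕ) = 2 ^ 5 from rfl, Nat.testBit_mod_two_pow]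
    simp [hi]
  simp only [odd, h 0 (by norm_num), h 1 (by norm_num), h 2 (by norm_num), h 3 (by norm_num),
    h 4 (by norm_num)]

theorem odd_mod (m a : ℕ) : odd m (a % 32) = odd m a := by
  have h : ∀ i < 5, (a % 32).testBit i = a.testBit i := by
    intro i hi
    rw [show (32 : ℕ) = 2 ^ 5 from rfl, Nat.testBit_mod_two_pow]
    simp [hi]
  simp only [odd, h 0 (by norm_num), h 1 (by norm_num), h 2 (by norm_num), h 3 (by norm_num),
    h 4 (by norm_num)]

theorem testBit_evenTable {m a : ℕ} (hm : m < 32) (ha : a < 32) :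
    evenTable.testBit (32 * a + m) = !odd m a := by
  have : ∀ a < 32, ∀ m < 32, evenTable.testBit (32 * a + m) = !odd m a := by decide +kernel
  exact this a ha m hm

theorem entry_testBit (tab s i : ℕ) :
    (entry tab s).testBit i = (decide (i < 6) && tab.testBit (8 * s + i)) := by
  have : entry tab s = (tab >>> (8 * s)) % 2 ^ 6 := rfl
  rw [this, Nat.testBit_mod_two_pow, Nat.testBit_shiftRight]

theorem testBit_eq_false_of_lt_64 {r i : ℕ} (hr : r < 64) (hi : 6 ≤ i) : r.testBit i = false :=
  Nat.testBit_eq_false_of_lt (hr.trans_le (Nat.pow_le_pow_right (n := 2) (by norm_num) hi))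

/-- Entries take six bits in disjoint blocks of eight. -/
theorem entry_lor_ne {tab r s s' : ℕ} (hr : r < 64) (h : s' ≠ s) :
    entry (tab ||| r <<< (8 * s)) s' = entry tab s' := by
  refine Nat.eq_of_testBit_eq fun i => ?_
  rw [entry_testBit, entry_testBit, Nat.testBit_or, Nat.testBit_shiftLeft]
  by_cases hi : i < 6
  · by_cases h1 : 8 * s ≤ 8 * s' + i
    · rw [testBit_eq_false_of_lt_64 hr (by omega)]
      simp
    · simp [h1]
  · simp [hi]

theorem entry_lor_self {tab r s : ℕ} (hr : r < 64) (h : entry tab s = 0) :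
    entry (tab ||| r <<< (8 * s)) s = r := by
  refine Nat.eq_of_testBit_eq fun i => ?_
  have h0 := entry_testBit tab s i
  rw [h, Nat.zero_testBit] at h0
  rw [entry_testBit, Nat.testBit_or, Bool.and_or_distrib_left, ← h0, Nat.testBit_shiftLeft]
  by_cases hi : i < 6
  · simp [hi]
  · simp [hi, testBit_eq_false_of_lt_64 hr (Nat.le_of_not_lt hi)]

/-- An occupied entry is never overwritten. The first pair with a given sum is recorded exactly, and
each later one removes from `V` the characters that disagree with the record; so a surviving
character is computed by the table on all new pairs. -/
theorem addSums_sound {p t e : ℕ} {k : ℕ → ℕ → Bool} (L : List (ℕ × ℕ)) (tab V : ℕ)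
    (h : addSums p t e L tab V k = true) :
    ∃ tab' V', k tab' V' = true ∧ (∀ s, entry tab s ≠ 0 → entry tab' s = entry tab s) ∧
      ∀ m < 32, V'.testBit m = true → V.testBit m = true ∧ ∀ x ∈ L,
        entry tab' ((t + x.1) % p) ≠ 0 ∧
          odd m (entry tab' ((t + x.1) % p)) = (odd m e ^^ odd m x.2) := by
  induction L generalizing tab V with
  | nil =>
    exact ⟨tab, V, h, fun _ _ => rfl, fun m _ hm => ⟨hm, fun x hx => absurd hx List.not_mem_nil⟩⟩
  | cons x L ih =>
    set s := (t + x.1) % p with hs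
    set r := 32 ||| (e ^^^ x.2) % 32 with hr
    have hr64 : r < 64 := by
      have h1 : 32 < 2 ^ 6 := by norm_num
      have h2 : (e ^^^ x.2) % 32 < 2 ^ 6 := (Nat.mod_lt _ (by norm_num)).trans (by norm_num)
      exact Nat.or_lt_two_pow h1 h2
    have hr0 : r ≠ 0 := by
      have : 32 ≤ r := Nat.left_le_or
      omega
    have hodd : ∀ m, odd m r = (odd m e ^^ odd m x.2) := fun m => by
      rw [hr, odd_lor_mod, odd_xor]
    have hunf : addSums p t e (x :: L) tab V k = Bool.rec (motive := fun _ => Bool)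
        (addSums p t e L tab (V &&& evenTable >>> (32 * ((entry tab s ^^^ r) % 32))) k)
        (addSums p t e L (tab ||| r <<< (8 * s)) V k) (Nat.beq (entry tab s) 0) := by
      simp only [addSums, force_eq]
      rfl
    rw [hunf] at h
    by_cases h0 : entry tab s = 0
    · have hb : Nat.beq (entry tab s) 0 = true := by rw [h0]; rfl
      rw [hb] at h
      obtain ⟨tab', V', hk, hp, hV⟩ := ih _ _ h
      refine ⟨tab', V', hk, fun s' hs' => ?_, fun m hm hmV => ⟨(hV m hm hmV).1, fun y hy => ?_⟩⟩
      · have hne : s' ≠ s := fun e => hs' (e ▸ h0)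
        rw [hp, entry_lor_ne hr64 hne]
        rwa [entry_lor_ne hr64 hne]
      · rcases List.mem_cons.1 hy with rfl | hy
        · have he : entry tab' s = r := by
            rw [hp, entry_lor_self hr64 h0]
            rwa [entry_lor_self hr64 h0]
          rw [← hs, he]
          exact ⟨hr0, hodd m⟩
        · exact (hV m hm hmV).2 y hy
    · have hb : Nat.beq (entry tab s) 0 = false := by
        cases hb : Nat.beq (entry tab s) 0
        · rfl
        · exact absurd (Nat.eq_of_beq_eq_true hb) h0
      rw [hb] at h
      obtain ⟨tab', V', hk, hp, hV⟩ := ih _ _ h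
      refine ⟨tab', V', hk, hp, fun m hm hmV => ?_⟩
      have h1 := (hV m hm hmV).1
      rw [Nat.testBit_and, Nat.testBit_shiftRight, Bool.and_eq_true,
        testBit_evenTable hm (Nat.mod_lt _ (by norm_num)), odd_mod, odd_xor] at h1
      refine ⟨h1.1, fun y hy => ?_⟩
      rcases List.mem_cons.1 hy with rfl | hy
      · rw [← hs, hp s h0, ← hodd]
        refine ⟨h0, ?_⟩
        have := h1.2
        revert this
        cases odd m (entry tab s) <;> cases odd m r <;> simp
      · exact (hV m hm hmV).2 y hy

theorem loop_sound {f : ℕ → Bool} {cnt t : ℕ} (h : loop f cnt t = true) :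
    ∀ u, t ≤ u → u < t + cnt → f u = true := by
  induction cnt generalizing t with
  | zero =>
    intro u h1 h2
    omega
  | succ n ih =>
    have h' : Bool.rec (motive := fun _ => Bool) false (loop f n (t + 1)) (f t) = true := by
      have : loop f (n + 1) t = Bool.rec (motive := fun _ => Bool) false
          (force (Nat.succ t) (loop f n)) (f t) := rfl
      rwa [this, force_eq] at h
    intro u h1 h2
    cases hf : f t with
    | false => rw [hf] at h'; exact absurd h' Bool.false_ne_true
    | true =>
      rw [hf] at h'
      rcases h1.eq_or_lt with rfl | h3
      · exact hf
      · exact ih h' u h3 (by omega)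

/-- The characters in `V` agree on all pairs of elements of `T` with the same sum, and these sums
are recorded in `tab`. -/
def Invariant (p : ℕ) (T : List (ℕ × ℕ)) (tab V : ℕ) : Prop :=
  ∀ m < 32, V.testBit m = true → ∀ x ∈ T, ∀ y ∈ T, entry tab ((x.1 + y.1) % p) ≠ 0 ∧
    odd m (entry tab ((x.1 + y.1) % p)) = (odd m x.2 ^^ odd m y.2)

/-- The new element is itself in the list that is run through, so its double is recorded as well.
Old pairs keep their entries, and characters are only lost. -/
theorem Invariant.addSums {p t e tab V : ℕ} {T : List (ℕ × ℕ)} {k : ℕ → ℕ → Bool}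
    (hI : Invariant p T tab V) (h : addSums p t e ((t, e) :: T) tab V k = true) :
    ∃ tab' V', k tab' V' = true ∧ Invariant p ((t, e) :: T) tab' V' := by
  obtain ⟨tab', V', hk, hp, hV⟩ := addSums_sound _ _ _ h
  refine ⟨tab', V', hk, fun m hm hmV x hx y hy => ?_⟩
  obtain ⟨hmV', hnew⟩ := hV m hm hmV
  rcases List.mem_cons.1 hx with rfl | hx'
  · exact hnew y hy
  rcases List.mem_cons.1 hy with rfl | hy'
  · rw [add_comm, Bool.xor_comm]
    exact hnew x hx
  · have := hI m hm hmV' x hx' y hy'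
    rw [hp _ this.1]
    exact this

/-- The labelled list that arises from `T` by adding the elements of `l`. -/
def extend (e : ℕ) : List ℕ → List (ℕ × ℕ) → List (ℕ × ℕ)
  | [], T => T
  | t :: l, T => extend (2 * e) l ((t, e) :: T)

/-- None of the elements of `l` is skipped when it is added to `T`. -/
def Unskipped (skip : ℕ → List (ℕ × ℕ) → Bool) (e : ℕ) : List ℕ → List (ℕ × ℕ) → Prop
  | [], _ => True
  | t :: l, T => skip t T = false ∧ Unskipped skip (2 * e) l ((t, e) :: T)

/-- There is a nonconstant character that agrees on all pairs with the same sum, or `T` is `good`. -/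
def Passes (p : ℕ) (good : List (ℕ × ℕ) → Bool) (T : List (ℕ × ℕ)) : Prop :=
  good T = true ∨ ∃ m, (∃ x ∈ T, odd m x.2 = true) ∧ ∀ x ∈ T, ∀ y ∈ T, ∀ x' ∈ T, ∀ y' ∈ T,
    (x.1 + y.1) % p = (x'.1 + y'.1) % p → (odd m x.2 ^^ odd m y.2) = (odd m x'.2 ^^ odd m y'.2)

theorem odd_two_pow {m i : ℕ} (hi : i < 5) : odd m (2 ^ i) = m.testBit i := by
  interval_cases i <;> simp [odd, Nat.testBit, Nat.shiftRight_eq_div_pow]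

/-- A nonzero `m < 2 ^ j` has a binary digit `l < j`, and its character is nontrivial on the element
labelled `2 ^ l`. -/
theorem check_sound {p j tab V : ℕ} {good : List (ℕ × ℕ) → Bool} {T : List (ℕ × ℕ)}
    (hj : j ≤ 5) (hT : ∀ i < j, ∃ x ∈ T, x.2 = 2 ^ i) (hI : Invariant p T tab V)
    (h : check good (2 ^ j) T V = true) : Passes p good T := by
  rcases eq_or_ne ((V % 1 <<< 2 ^ j) >>> 1) 0 with h0 | h0
  · left
    have hb : Nat.beq (Nat.shiftRight (Nat.mod V (Nat.shiftLeft 1 (2 ^ j))) 1) 0 = true :=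
      (Nat.beq_eq (x := _) (y := _)).mpr h0
    rwa [check, hb] at h
  · right
    obtain ⟨i, hi⟩ := Nat.exists_testBit_of_ne_zero h0
    rw [Nat.testBit_shiftRight, Nat.one_shiftLeft, Nat.testBit_mod_two_pow, Bool.and_eq_true,
      decide_eq_true_eq] at hi
    set m := 1 + i with hm
    have hm32 : m < 32 := hi.1.trans_le (Nat.pow_le_pow_right (n := 2) (by norm_num) hj)
    refine ⟨m, ?_, fun x hx y hy x' hx' y' hy' hs => ?_⟩
    · obtain ⟨l, hl⟩ := Nat.exists_testBit_of_ne_zero (x := m) (by omega)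
      have hlj : l < j := by
        have := Nat.ge_two_pow_of_testBit hl
        exact (Nat.pow_lt_pow_iff_right (a := 2) (by norm_num)).1 (this.trans_lt hi.1)
      obtain ⟨x, hx, hxl⟩ := hT l hlj
      exact ⟨x, hx, by rw [hxl, odd_two_pow (hlj.trans_le hj), hl]⟩
    · have h1 := (hI m hm32 hi.2 x hx y hy).2
      have h2 := (hI m hm32 hi.2 x' hx' y' hy').2
      rw [← h1, ← h2, hs]

/-- An increasing list is one branch of the search tree; the invariant is carried along this branch,
which is not cut off because nothing on it is skipped. -/
theorem search_sound {p : ℕ} {skip : ℕ → List (ℕ × ℕ) → Bool} {good : List (ℕ × ℕ) → Bool} (n : ℕ)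
    {lo j tab V : ℕ} {T : List (ℕ × ℕ)} (hj : j + n ≤ 5) (hT : ∀ i < j, ∃ x ∈ T, x.2 = 2 ^ i)
    (hI : Invariant p T tab V) (h : search p skip good n lo (2 ^ j) T tab V = true)
    (l : List ℕ) (hln : l.length ≤ n) (hl : l.Pairwise (· < ·)) (hlo : ∀ t ∈ l, lo ≤ t ∧ t < p)
    (hskip : Unskipped skip (2 ^ j) l T) : Passes p good (extend (2 ^ j) l T) := by
  induction n generalizing lo j tab V T l with
  | zero =>
    obtain rfl : l = [] := List.length_eq_zero_iff.1 (Nat.le_zero.1 hln)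
    exact check_sound (by omega) hT hI h
  | succ n ih =>
    have hunf : search p skip good (n + 1) lo (2 ^ j) T tab V =
        Bool.rec (motive := fun _ => Bool) false (loop (fun t => Bool.rec (motive := fun _ => Bool)
          (RigidSearch.addSums p t (2 ^ j) ((t, 2 ^ j) :: T) tab V fun tab' V' =>
            search p skip good n (t + 1) (2 * 2 ^ j) ((t, 2 ^ j) :: T) tab' V')
          true (skip t T)) (p - lo) lo) (check good (2 ^ j) T V) := by
      simp only [search, force_eq]
      rfl
    rw [hunf] at h
    cases hc : check good (2 ^ j) T V with
    | false => rw [hc] at h; exact absurd h Bool.false_ne_true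
    | true =>
      rw [hc] at h
      cases l with
      | nil => exact check_sound (by omega) hT hI hc
      | cons t l =>
        have ht := hlo t List.mem_cons_self
        have h' := loop_sound h t ht.1 (by omega)
        simp only [hskip.1] at h'
        obtain ⟨tab', V', hk, hI'⟩ := hI.addSums h'
        have hl' := List.pairwise_cons.1 hl
        have e2 : 2 * 2 ^ j = 2 ^ (j + 1) := by rw [pow_succ, mul_comm]
        have hs' := hskip.2
        rw [e2] at hk hs'
        rw [extend, e2]
        refine ih (by omega) (fun i hi => ?_) hI' hk l (Nat.le_of_succ_le_succ hln) hl'.2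
          (fun u hu => ⟨hl'.1 u hu, (hlo u (List.mem_cons_of_mem _ hu)).2⟩) hs'
        rcases (Nat.lt_succ_iff.1 hi).eq_or_lt with rfl | hi
        · exact ⟨_, List.mem_cons_self, rfl⟩
        · obtain ⟨x, hx, hxi⟩ := hT i hi
          exact ⟨x, List.mem_cons_of_mem _ hx, hxi⟩

end RigidSearch

/-! ### Parity rigid sets -/

/-- All functions to `Bool` that agree on pairs with the same sum are constant on `S`. -/
def IsParityRigid {p : ℕ} (S : Set (ZMod p)) : Prop :=
  ∀ f : ZMod p → Bool, (∀ a ∈ S, ∀ b ∈ S, ∀ c ∈ S, ∀ d ∈ S, a + b = c + d →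
    (f a ^^ f b) = (f c ^^ f d)) → ∀ a ∈ S, ∀ b ∈ S, f a = f b

/-- Affine maps preserve the relation `a + b = c + d`, so functions on the image pull back to `S`.
-/
theorem IsParityRigid.image {p : ℕ} {S : Set (ZMod p)} (h : IsParityRigid S) (u v : ZMod p) :
    IsParityRigid ((fun x => u * x + v) '' S) := by
  intro f hf
  have key := h (fun x => f (u * x + v)) fun a ha b hb c hc d hd e =>
    hf _ ⟨a, ha, rfl⟩ _ ⟨b, hb, rfl⟩ _ ⟨c, hc, rfl⟩ _ ⟨d, hd, rfl⟩
      (by linear_combination u * e)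
  rintro _ ⟨a, ha, rfl⟩ _ ⟨b, hb, rfl⟩
  exact key a ha b hb

/-! ### From labelled lists to subsets of `ZMod p` -/

namespace RigidSearch

theorem subset_extend (l : List ℕ) (e : ℕ) (T : List (ℕ × ℕ)) : T ⊆ extend e l T := by
  induction l generalizing e T with
  | nil => exact List.Subset.refl _
  | cons t l ih => exact List.Subset.trans (List.subset_cons_self _ _) (ih _ _)

theorem mem_extend {l : List ℕ} {e : ℕ} {T : List (ℕ × ℕ)} {x : ℕ × ℕ} (h : x ∈ extend e l T) :
    x ∈ T ∨ x.1 ∈ l := by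
  induction l generalizing e T with
  | nil => exact Or.inl h
  | cons t l ih =>
    rcases ih h with h | h
    · rcases List.mem_cons.1 h with rfl | h
      · exact Or.inr List.mem_cons_self
      · exact Or.inl h
    · exact Or.inr (List.mem_cons_of_mem _ h)

theorem exists_mem_extend {l : List ℕ} {e t : ℕ} {T : List (ℕ × ℕ)} (h : t ∈ l) :
    ∃ x ∈ extend e l T, x.1 = t := by
  induction l generalizing e T with
  | nil => exact absurd h List.not_mem_nil
  | cons u l ih =>
    rcases List.mem_cons.1 h with rfl | h
    · exact ⟨(t, e), subset_extend l _ _ List.mem_cons_self, rfl⟩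
    · exact ih h

theorem extend_injective {l : List ℕ} {e lo : ℕ} {T : List (ℕ × ℕ)} (hT : ∀ x ∈ T, x.1 < lo)
    (hinj : ∀ x ∈ T, ∀ y ∈ T, x.1 = y.1 → x = y) (hl : l.Pairwise (· < ·)) (hlo : ∀ t ∈ l, lo ≤ t) :
    ∀ x ∈ extend e l T, ∀ y ∈ extend e l T, x.1 = y.1 → x = y := by
  induction l generalizing e lo T with
  | nil => exact hinj
  | cons t l ih =>
    have hl' := List.pairwise_cons.1 hl
    have ht := hlo t List.mem_cons_self
    refine ih (lo := t + 1) ?_ ?_ hl'.2 fun u hu => hl'.1 u hu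
    · intro x hx
      rcases List.mem_cons.1 hx with rfl | hx
      · exact Nat.lt_succ_self _
      · have := hT x hx
        omega
    · intro x hx y hy hxy
      rcases List.mem_cons.1 hx with rfl | hx <;> rcases List.mem_cons.1 hy with rfl | hy
      · rfl
      · have := hT y hy
        simp only at hxy
        omega
      · have := hT x hx
        simp only at hxy
        omega
      · exact hinj x hx y hy hxy

variable {p : ℕ}

theorem makesProgression_eq_false {S : Set (ZMod p)} (hS : ∀ a ∈ S, ∀ b ∈ S, ∀ c ∈ S,
    a + c = 2 * b → a = c) {t : ℕ} {T : List (ℕ × ℕ)} (htp : t < p) (hT : ∀ x ∈ T, x.1 < t)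
    (htS : (t : ZMod p) ∈ S) (hTS : ∀ x ∈ T, (x.1 : ZMod p) ∈ S) :
    makesProgression p t T = false := by
  have hcast : ∀ a b : ℕ, a % p = b % p → (a : ZMod p) = b := fun a b h =>
    (ZMod.natCast_eq_natCast_iff' a b p).2 h
  have hcast' : ∀ a b : ℕ, a < p → b < p → (a : ZMod p) = b → a = b := fun a b ha hb h => by
    have := (ZMod.natCast_eq_natCast_iff' a b p).1 h
    rwa [Nat.mod_eq_of_lt ha, Nat.mod_eq_of_lt hb] at this
  rw [Bool.eq_false_iff]
  intro h
  obtain ⟨x, hx, h⟩ := List.any_eq_true.1 h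
  obtain ⟨y, hy, h⟩ := List.any_eq_true.1 h
  have hxt := hT x hx
  have hyt := hT y hy
  cases hxy : Nat.beq x.1 y.1 with
  | true => rw [hxy] at h; exact absurd h Bool.false_ne_true
  | false =>
    rw [hxy] at h
    have hne : x.1 ≠ y.1 := fun e => by
      rw [e, Nat.beq_refl] at hxy
      exact Bool.noConfusion hxy
    cases h1 : Nat.beq (Nat.mod (Nat.add t x.1) p) (Nat.mod (Nat.mul 2 y.1) p) with
    | true =>
      have := hcast (t + x.1) (2 * y.1) (Nat.eq_of_beq_eq_true h1)
      push_cast at this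
      have := hcast' _ _ htp (hxt.trans htp) (hS _ htS _ (hTS y hy) _ (hTS x hx) this)
      omega
    | false =>
      rw [h1] at h
      have := hcast (x.1 + y.1) (2 * t) (Nat.eq_of_beq_eq_true h)
      push_cast at this
      exact hne (hcast' _ _ (hxt.trans htp) (hyt.trans htp)
        (hS _ (hTS x hx) _ htS _ (hTS y hy) this))

theorem unskipped_makesProgression {S : Set (ZMod p)} (hS : ∀ a ∈ S, ∀ b ∈ S, ∀ c ∈ S,
    a + c = 2 * b → a = c) {l : List ℕ} {e lo : ℕ} {T : List (ℕ × ℕ)} (hT : ∀ x ∈ T, x.1 < lo)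
    (hl : l.Pairwise (· < ·)) (hlo : ∀ t ∈ l, lo ≤ t ∧ t < p) (hlS : ∀ t ∈ l, (t : ZMod p) ∈ S)
    (hTS : ∀ x ∈ T, (x.1 : ZMod p) ∈ S) : Unskipped (makesProgression p) e l T := by
  induction l generalizing e lo T with
  | nil => trivial
  | cons t l ih =>
    have hl' := List.pairwise_cons.1 hl
    have ht := hlo t List.mem_cons_self
    have htS := hlS t List.mem_cons_self
    refine ⟨makesProgression_eq_false hS ht.2 (fun x hx => (hT x hx).trans_le ht.1) htS hTS, ?_⟩
    refine ih (lo := t + 1) ?_ hl'.2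
      (fun u hu => ⟨hl'.1 u hu, (hlo u (List.mem_cons_of_mem _ hu)).2⟩)
      (fun u hu => hlS u (List.mem_cons_of_mem _ hu)) ?_
    · intro x hx
      rcases List.mem_cons.1 hx with rfl | hx
      · exact Nat.lt_succ_self _
      · have := hT x hx
        omega
    · intro x hx
      rcases List.mem_cons.1 hx with rfl | hx
      · exact htS
      · exact hTS x hx

theorem unskipped_false (l : List ℕ) (e : ℕ) (T : List (ℕ × ℕ)) :
    Unskipped (fun _ _ => false) e l T := by
  induction l generalizing e T with
  | nil => trivial
  | cons t l ih => exact ⟨rfl, ih _ _⟩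

/-- A parity rigid set that passes is `good`. -/
theorem Passes.good_eq_true {S : Set (ZMod p)} (hS : IsParityRigid S)
    {good : List (ℕ × ℕ) → Bool} {T : List (ℕ × ℕ)} (h : Passes p good T) (h0 : (0, 0) ∈ T)
    (hTp : ∀ x ∈ T, x.1 < p) (hinj : ∀ x ∈ T, ∀ y ∈ T, x.1 = y.1 → x = y)
    (hTS : ∀ x ∈ T, (x.1 : ZMod p) ∈ S) (hST : ∀ s ∈ S, ∃ x ∈ T, (x.1 : ZMod p) = s) :
    good T = true := by
  classical
  rcases h with h | ⟨m, ⟨x₁, hx₁, hm₁⟩, hm⟩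
  · exact h
  exfalso
  -- The character `m` as a function on `S`: it is `false` at `0` and `true` at `x₁`, which
  -- contradicts rigidity.
  let f : ZMod p → Bool := fun s => decide (∃ x ∈ T, (x.1 : ZMod p) = s ∧ odd m x.2 = true)
  have hf : ∀ x ∈ T, f x.1 = odd m x.2 := by
    intro x hx
    rw [Bool.eq_iff_iff, decide_eq_true_eq]
    constructor
    · rintro ⟨y, hy, hyx, hym⟩
      have := (ZMod.natCast_eq_natCast_iff' y.1 x.1 p).1 hyx
      rw [Nat.mod_eq_of_lt (hTp y hy), Nat.mod_eq_of_lt (hTp x hx)] at this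
      rwa [← hinj y hy x hx this]
    · intro h
      exact ⟨x, hx, rfl, h⟩
  have hc := hS f ?_ _ (hTS _ hx₁) _ (hTS _ h0)
  · rw [hf _ hx₁, hf _ h0, hm₁] at hc
    have : odd m 0 = false := by simp [odd]
    rw [this] at hc
    exact Bool.noConfusion hc
  · intro a ha b hb c hc d hd e
    obtain ⟨x, hx, rfl⟩ := hST a ha
    obtain ⟨y, hy, rfl⟩ := hST b hb
    obtain ⟨x', hx', rfl⟩ := hST c hc
    obtain ⟨y', hy', rfl⟩ := hST d hd
    rw [hf x hx, hf y hy, hf x' hx', hf y' hy']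
    refine hm x hx y hy x' hx' y' hy' ((ZMod.natCast_eq_natCast_iff' _ _ p).1 ?_)
    push_cast
    exact e

/-- The elements of `S` from `lo` on, in increasing order. -/
def above (S : Finset (ZMod p)) (lo : ℕ) : List ℕ := ((S.image ZMod.val).filter (lo ≤ ·)).sort

theorem mem_above [NeZero p] {S : Finset (ZMod p)} {lo t : ℕ} :
    t ∈ above S lo ↔ lo ≤ t ∧ t < p ∧ (t : ZMod p) ∈ S := by
  rw [above, Finset.mem_sort, Finset.mem_filter, Finset.mem_image]
  constructor
  · rintro ⟨⟨s, hs, rfl⟩, h⟩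
    refine ⟨h, ZMod.val_lt s, ?_⟩
    rwa [ZMod.natCast_zmod_val]
  · rintro ⟨h1, h2, h3⟩
    exact ⟨⟨_, h3, ZMod.val_cast_of_lt h2⟩, h1⟩

theorem pairwise_above (S : Finset (ZMod p)) (lo : ℕ) : (above S lo).Pairwise (· < ·) :=
  (Finset.sortedLT_sort _).pairwise

/-- A search over the sets that contain the elements of `T₀`, and no others below `lo`. -/
theorem good_of_search [NeZero p] {skip : ℕ → List (ℕ × ℕ) → Bool} {good : List (ℕ × ℕ) → Bool}
    {n lo j tab V : ℕ} {T₀ : List (ℕ × ℕ)} (hj : j + n ≤ 5) (hT : ∀ i < j, ∃ x ∈ T₀, x.2 = 2 ^ i)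
    (hI : Invariant p T₀ tab V) (h : search p skip good n lo (2 ^ j) T₀ tab V = true)
    (h0 : (0, 0) ∈ T₀) (hlo : ∀ x ∈ T₀, x.1 < lo) (hlop : lo ≤ p)
    (hinj : ∀ x ∈ T₀, ∀ y ∈ T₀, x.1 = y.1 → x = y) (hcov : ∀ t < lo, ∃ x ∈ T₀, x.1 = t)
    {S : Finset (ZMod p)} (hS : IsParityRigid (S : Set (ZMod p)))
    (hT₀S : ∀ x ∈ T₀, (x.1 : ZMod p) ∈ S) (hcard : S.card ≤ n + lo)
    (hskip : Unskipped skip (2 ^ j) (above S lo) T₀) :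
    good (extend (2 ^ j) (above S lo) T₀) = true ∧
      ∀ s ∈ S, ∃ x ∈ extend (2 ^ j) (above S lo) T₀, (x.1 : ZMod p) = s := by
  have hpw := pairwise_above S lo
  have hST : ∀ s ∈ S, ∃ x ∈ extend (2 ^ j) (above S lo) T₀, (x.1 : ZMod p) = s := by
    intro s hs
    rcases lt_or_ge s.val lo with h | h
    · obtain ⟨x, hx, hxs⟩ := hcov _ h
      exact ⟨x, subset_extend _ _ _ hx, by rw [hxs, ZMod.natCast_zmod_val]⟩
    · obtain ⟨x, hx, hxs⟩ := exists_mem_extend (e := 2 ^ j) (T := T₀) (l := above S lo) (t := s.val)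
        (mem_above.2 ⟨h, ZMod.val_lt s, by rwa [ZMod.natCast_zmod_val]⟩)
      exact ⟨x, hx, by rw [hxs, ZMod.natCast_zmod_val]⟩
  have hlen : (above S lo).length ≤ n := by
    have h1 : (above S lo).length = ((S.image ZMod.val).filter (lo ≤ ·)).card :=
      Finset.length_sort _
    -- The elements below `lo` are exactly those of `T₀`; they use up `lo` of the `n + lo` elements
    -- allowed.
    have h2 : (Finset.range lo).card ≤ ((S.image ZMod.val).filter (¬ lo ≤ ·)).card := by
      refine Finset.card_le_card fun t ht => ?_
      rw [Finset.mem_range] at ht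
      obtain ⟨x, hx, rfl⟩ := hcov t ht
      rw [Finset.mem_filter, Finset.mem_image]
      exact ⟨⟨_, hT₀S x hx, ZMod.val_cast_of_lt (ht.trans_le hlop)⟩, by omega⟩
    have h3 := Finset.card_filter_add_card_filter_not (s := S.image ZMod.val) (lo ≤ ·)
    have h4 : (S.image ZMod.val).card ≤ S.card := Finset.card_image_le
    rw [Finset.card_range] at h2
    omega
  have hpass := search_sound n hj hT hI h (above S lo) hlen hpw
    (fun t ht => ⟨(mem_above.1 ht).1, (mem_above.1 ht).2.1⟩) hskip
  refine ⟨hpass.good_eq_true hS (subset_extend _ _ _ h0) (fun x hx => ?_)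
    (extend_injective hlo hinj hpw fun t ht => (mem_above.1 ht).1) (fun x hx => ?_) hST, hST⟩
  · rcases mem_extend hx with hx | hx
    · exact (hlo x hx).trans_le hlop
    · exact (mem_above.1 hx).2.1
  · rcases mem_extend hx with hx | hx
    · exact hT₀S x hx
    · exact (mem_above.1 hx).2.2

theorem invariant_nil (p tab V : ℕ) : Invariant p [] tab V :=
  fun _ _ _ _ hx => absurd hx List.not_mem_nil

/-- Here no set is `good`, so passing the search means having a nonconstant function. -/
theorem not_isParityRigid_of_search [NeZero p] {n : ℕ} (hn : n ≤ 4) (hp : 2 ≤ p)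
    (h : searchNoProgression p n = true) {S : Finset (ZMod p)} (hcard : S.card ≤ n + 2)
    (h0 : 0 ∈ S) (h1 : 1 ∈ S) (hS : ∀ a ∈ S, ∀ b ∈ S, ∀ c ∈ S, a + c = 2 * b → a = c) :
    ¬ IsParityRigid (S : Set (ZMod p)) := by
  intro hr
  obtain ⟨tab, V, h, hI⟩ := (invariant_nil p _ _).addSums h
  obtain ⟨tab, V, h, hI⟩ := hI.addSums h
  have hT₀S : ∀ x ∈ [((1 : ℕ), (1 : ℕ)), (0, 0)], (x.1 : ZMod p) ∈ S := by
    simpa using ⟨h1, h0⟩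
  have := (good_of_search (j := 1) (by omega) (by simp) hI h (by simp) (by simp) hp
    (by simp) (by intro t ht; interval_cases t <;> simp) hr hT₀S hcard
    (unskipped_makesProgression (S := S) hS (lo := 2) (by simp) (pairwise_above S 2)
      (fun t ht => ⟨(mem_above.1 ht).1, (mem_above.1 ht).2.1⟩)
      (fun t ht => (mem_above.1 ht).2.2) hT₀S)).1
  exact Bool.noConfusion this

theorem exists_affine_of_search [NeZero p] {n : ℕ} (hn : n ≤ 3) (hp : 3 ≤ p)
    {Rs : List (List ℕ)} (hRs : ∀ R ∈ Rs, ∀ r ∈ R, r < p)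
    (h : searchProgression p Rs n = true) {S : Finset (ZMod p)} (hcard : S.card ≤ n + 3)
    (h0 : 0 ∈ S) (h1 : 1 ∈ S) (h2 : 2 ∈ S) (hr : IsParityRigid (S : Set (ZMod p))) :
    ∃ R ∈ Rs, ∃ u v : ZMod p, u ≠ 0 ∧ ∀ s ∈ S, ∃ r ∈ R, (r : ZMod p) = u * s + v := by
  obtain ⟨tab, V, h, hI⟩ := (invariant_nil p _ _).addSums h
  obtain ⟨tab, V, h, hI⟩ := hI.addSums h
  obtain ⟨tab, V, h, hI⟩ := hI.addSums h
  have hT₀S : ∀ x ∈ [((2 : ℕ), (2 : ℕ)), (1, 1), (0, 0)], (x.1 : ZMod p) ∈ S := by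
    simpa using ⟨h2, h1, h0⟩
  obtain ⟨hg, hcov⟩ := good_of_search (j := 2) (by omega)
    (by intro i hi; interval_cases i <;> simp) hI h (by simp) (by simp) hp
    (by simp) (by intro t ht; interval_cases t <;> simp) hr hT₀S hcard (unskipped_false _ _ _)
  obtain ⟨R, hR, hg⟩ := List.any_eq_true.1 hg
  obtain ⟨b, hb, hg⟩ := List.any_eq_true.1 hg
  obtain ⟨c, hc, hg⟩ := List.any_eq_true.1 hg
  have hbp := hRs R hR b hb
  have hcp := hRs R hR c hc
  cases hbc : Nat.beq b c with
  | true => rw [hbc] at hg; exact absurd hg Bool.false_ne_true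
  | false =>
    rw [hbc] at hg
    have hne : b ≠ c := fun e => by
      rw [e, Nat.beq_refl] at hbc
      exact Bool.noConfusion hbc
    -- The affine map with `0 ↦ b` and `1 ↦ c`.
    refine ⟨R, hR, (c : ZMod p) - b, b, fun e => hne ?_, fun s hs => ?_⟩
    · have := (ZMod.natCast_eq_natCast_iff' b c p).1 (sub_eq_zero.1 e).symm
      rwa [Nat.mod_eq_of_lt hbp, Nat.mod_eq_of_lt hcp] at this
    · obtain ⟨x, hx, rfl⟩ := hcov s hs
      have := List.all_eq_true.1 hg x hx
      rw [force_eq] at this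
      obtain ⟨r, hr, hr'⟩ := List.any_eq_true.1 this
      refine ⟨r, hr, ?_⟩
      have e : r = (b + (c + p - b) * x.1) % p := Nat.eq_of_beq_eq_true hr'
      rw [e, ZMod.natCast_mod]
      push_cast [Nat.cast_sub (show b ≤ c + p by omega)]
      rw [ZMod.natCast_self]
      ring

end RigidSearch

/-- A parity rigid set that is not too large is mapped into one of the listed sets by an
affine map. -/
theorem IsParityRigid.exists_affine {p : ℕ} [Fact p.Prime] {n : ℕ} (hn : n ≤ 3) (hp : 3 ≤ p)
    {Rs : List (List ℕ)} (hRs : ∀ R ∈ Rs, ∀ r ∈ R, r < p)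
    (h1 : RigidSearch.searchProgression p Rs n = true)
    (h2 : RigidSearch.searchNoProgression p (n + 1) = true) {S : Set (ZMod p)}
    (hS : IsParityRigid S) (hcard : S.ncard ≤ n + 3) (hnt : S.Nontrivial) :
    ∃ R ∈ Rs, ∃ u v : ZMod p, u ≠ 0 ∧ ∀ s ∈ S, ∃ r ∈ R, (r : ZMod p) = u * s + v := by
  classical
  have hfin : ∀ u v : ZMod p, ∃ T : Finset (ZMod p), (T : Set (ZMod p)) = (fun x => u * x + v) '' S ∧
      T.card ≤ n + 3 := by
    intro u v
    refine ⟨((fun x => u * x + v) '' S).toFinite.toFinset, by simp, ?_⟩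
    rw [← Set.ncard_eq_toFinset_card]
    exact (Set.ncard_image_le S.toFinite).trans hcard
  -- A progression `a, b, c` is carried to `0, 1, 2` by `x ↦ (x - a) / (b - a)`.
  by_cases hap : ∃ a ∈ S, ∃ b ∈ S, ∃ c ∈ S, a + c = 2 * b ∧ a ≠ c
  · obtain ⟨a, ha, b, hb, c, hc, e, hac⟩ := hap
    have hab : b - a ≠ 0 := fun h => hac (by linear_combination -e - 2 * h)
    obtain ⟨T, hT, hTc⟩ := hfin (b - a)⁻¹ (-((b - a)⁻¹ * a))
    have hmem : ∀ x ∈ S, (b - a)⁻¹ * x + -((b - a)⁻¹ * a) ∈ T := fun x hx => by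
      rw [← Finset.mem_coe, hT]
      exact ⟨x, hx, rfl⟩
    have t0 : (0 : ZMod p) ∈ T := by
      have := hmem a ha
      rwa [add_neg_cancel] at this
    have t1 : (1 : ZMod p) ∈ T := by
      have := hmem b hb
      rwa [show (b - a)⁻¹ * b + -((b - a)⁻¹ * a) = (b - a)⁻¹ * (b - a) by ring,
        inv_mul_cancel₀ hab] at this
    have t2 : (2 : ZMod p) ∈ T := by
      have := hmem c hc
      rwa [show (b - a)⁻¹ * c + -((b - a)⁻¹ * a) = 2 * ((b - a)⁻¹ * (b - a)) by
        linear_combination (b - a)⁻¹ * e, inv_mul_cancel₀ hab, mul_one] at this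
    obtain ⟨R, hR, u, v, hu, huv⟩ := RigidSearch.exists_affine_of_search hn hp hRs h1 hTc t0 t1 t2
      (hT ▸ hS.image _ _)
    refine ⟨R, hR, u * (b - a)⁻¹, u * -((b - a)⁻¹ * a) + v, mul_ne_zero hu (inv_ne_zero hab),
      fun s hs => ?_⟩
    obtain ⟨r, hr, e⟩ := huv _ (hmem s hs)
    exact ⟨r, hr, by rw [e]; ring⟩
  · exfalso
    push Not at hap
    obtain ⟨a, ha, b, hb, hne⟩ := hnt
    have hab : b - a ≠ 0 := sub_ne_zero.2 hne.symm
    obtain ⟨T, hT, hTc⟩ := hfin (b - a)⁻¹ (-((b - a)⁻¹ * a))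
    have hmem : ∀ x ∈ S, (b - a)⁻¹ * x + -((b - a)⁻¹ * a) ∈ T := fun x hx => by
      rw [← Finset.mem_coe, hT]
      exact ⟨x, hx, rfl⟩
    have t0 : (0 : ZMod p) ∈ T := by
      have := hmem a ha
      rwa [add_neg_cancel] at this
    have t1 : (1 : ZMod p) ∈ T := by
      have := hmem b hb
      rwa [show (b - a)⁻¹ * b + -((b - a)⁻¹ * a) = (b - a)⁻¹ * (b - a) by ring,
        inv_mul_cancel₀ hab] at this
    -- Without a progression only two elements can be normalized, so one more is left to the search.
    refine RigidSearch.not_isParityRigid_of_search (n := n + 1) (by omega) (by omega) h2 hTc t0 t1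
      ?_ (hT ▸ hS.image _ _)
    intro x hx y hy z hz e
    rw [← Finset.mem_coe, hT] at hx hy hz
    obtain ⟨x, hx, rfl⟩ := hx
    obtain ⟨y, hy, rfl⟩ := hy
    obtain ⟨z, hz, rfl⟩ := hz
    have e' : (b - a)⁻¹ * (x + z) = (b - a)⁻¹ * (2 * y) := by linear_combination e
    rw [hap x hx y hy z hz (mul_left_cancel₀ (inv_ne_zero hab) e')]

/-! ### Vanishing of `θ_p` on colorings with few colors -/

/-- The antisymmetric function with the values `z` at `(x, y)`, for `(x, y, z)` in `G`. -/
def potential (p : ℕ) (G : List (ℕ × ℕ × ℕ)) (x y : ZMod p) : ZMod p :=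
  (G.map fun t => (if x = t.1 ∧ y = t.2.1 then (t.2.2 : ZMod p) else 0) -
    if y = t.1 ∧ x = t.2.1 then (t.2.2 : ZMod p) else 0).sum

theorem potential_swap (p : ℕ) (G : List (ℕ × ℕ × ℕ)) (x y : ZMod p) :
    potential p G y x = -potential p G x y := by
  induction G with
  | nil => simp [potential]
  | cons t G ih =>
    simp only [potential, List.map_cons, List.sum_cons] at ih ⊢
    rw [ih]
    ring

/-- On the colors in `R`, `θ_p` is the coboundary of the function given by `G`. -/
def IsPotential (p : ℕ) (R : List ℕ) (G : List (ℕ × ℕ × ℕ)) : Prop :=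
  ∀ a ∈ R, ∀ b ∈ R, ∀ c ∈ R, ∀ d ∈ R, (a + c : ZMod p) = b + d →
    thetaVal p a b c = potential p G a b + potential p G c a + potential p G d c + potential p G b d

instance (p : ℕ) (R : List ℕ) (G : List (ℕ × ℕ × ℕ)) : Decidable (IsPotential p R G) := by
  unfold IsPotential
  infer_instance

/-! ### Coboundaries and the reduction of the number of colors -/

namespace KnotDiagram

variable {D : KnotDiagram} {p : ℕ}

theorem glue_left {α : Type*} {F : Dart D.n → α} (h : ∀ d, F (turn (D.glue d) (-1)) = F d)
    (d : Dart D.n) : F (D.glue d) = F (turn d (-1)) := by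
  rw [← h (D.glue d), D.glue_glue]

/-- Each crossing contributes `g` of the two sides of its four darts. The two darts of a semi-arc
see these sides exchanged, so by antisymmetry the sum equals its own negative, and `2` is
invertible. -/
theorem thetaSum_eq_zero_of_coboundary [Fact p.Prime] (hp2 : p ≠ 2) {F : Dart D.n → ZMod p}
    (hF : IsCornerColoring D.glue F) (g : ZMod p → ZMod p → ZMod p) (hg : ∀ x y, g y x = -g x y)
    (h : ∀ v, thetaVal p (F (v, 0)) (F (v, 3)) (F (v, 1)) = g (F (v, 0)) (F (v, 3)) +
      g (F (v, 1)) (F (v, 0)) + g (F (v, 2)) (F (v, 1)) + g (F (v, 3)) (F (v, 2))) :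
    thetaSum F = 0 := by
  let w : Dart D.n → ZMod p := fun d => g (F d) (F (turn d (-1)))
  have hw : ∀ d, w (D.glue d) = -w d := by
    intro d
    simp only [w]
    rw [glue_left hF.face, hF.face, hg]
  have hsum : thetaSum F = ∑ d, w d := by
    rw [thetaSum, Fintype.sum_prod_type]
    refine Finset.sum_congr rfl fun v _ => ?_
    rw [h v]
    exact (Fin.sum_univ_four fun k : Fin 4 => w (v, k)).symm
  have hneg : ∑ d, w d = -∑ d, w d := by
    conv_lhs => rw [← Equiv.sum_comp D.glue]
    rw [← Finset.sum_neg_distrib]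
    exact Finset.sum_congr rfl fun d _ => hw d
  have h2 : (2 : ZMod p) ≠ 0 := by
    have : (2 : ZMod p) = ((2 : ℕ) : ZMod p) := by norm_num
    rw [this, Ne, ZMod.natCast_eq_zero_iff]
    exact fun hd => hp2 ((Nat.prime_dvd_prime_iff_eq Fact.out Nat.prime_two).1 hd)
  rw [hsum]
  have : (2 : ZMod p) * ∑ d, w d = 0 := by linear_combination hneg
  exact (mul_eq_zero.1 this).resolve_left h2

theorem thetaSum_eq_zero_of_isPotential [Fact p.Prime] (hp2 : p ≠ 2) {F : Dart D.n → ZMod p}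
    (hF : IsCornerColoring D.glue F) {R : List ℕ} {G : List (ℕ × ℕ × ℕ)} (h : IsPotential p R G)
    (hR : ∀ d, ∃ r ∈ R, (r : ZMod p) = F d) : thetaSum F = 0 := by
  refine thetaSum_eq_zero_of_coboundary hp2 hF (potential p G) (fun x y => potential_swap p G x y)
    fun v => ?_
  obtain ⟨a, ha, ea⟩ := hR (v, 0)
  obtain ⟨b, hb, eb⟩ := hR (v, 3)
  obtain ⟨c, hc, ec⟩ := hR (v, 1)
  obtain ⟨d, hd, ed⟩ := hR (v, 2)
  have := hF.crossing v
  rw [← ea, ← eb, ← ec, ← ed] at this ⊢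
  exact h a ha b hb c hc d hd (this.trans (add_comm _ _))

/-- A function of the colors that satisfies the coloring condition modulo `2` is constant or a
checkerboard coloring. -/
theorem parity_cases {F : Dart D.n → ZMod p} (hF : IsCornerColoring D.glue F) (f : ZMod p → Bool)
    (hf : ∀ v, (f (F (v, 0)) ^^ f (F (v, 1))) = (f (F (v, 2)) ^^ f (F (v, 3)))) :
    (∀ a b, f (F a) = f (F b)) ∨ ∀ d, f (F (turn d (-1))) = !f (F d) := by
  -- Modulo 2 the coloring condition says that the sum of the values at the two sides is kept along
  -- both strands of a crossing, so it is the same on all semi-arcs. If it is `0`, `f` never changes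
  -- across a semi-arc; if it is `1`, it always does.
  have key := D.const_of_glue_rot (fun d => f (F d) ^^ f (F (turn d (-1)))) ?_ ?_
  · rcases isEmpty_or_nonempty (Dart D.n) with he | ⟨⟨d₀⟩⟩
    · exact Or.inl fun a => he.elim a
    cases h0 : f (F d₀) ^^ f (F (turn d₀ (-1))) with
    | false =>
      left
      have h1 : ∀ d, f (F (turn d (-1))) = f (F d) := by
        intro d
        have := (key d d₀).trans h0
        revert this
        cases f (F d) <;> cases f (F (turn d (-1))) <;> simp
      refine D.const_of_glue_rot (fun d => f (F d)) (fun d => ?_) fun d => ?_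
      · rw [glue_left hF.face, h1]
      · have e1 := h1 (turn d 2)
        have e2 := h1 (turn (turn d 2) (-1))
        rw [turn_turn, turn_turn] at e2
        rw [← e1, ← e2]
        have : turn d (2 + (-1 + -1)) = d := turn_zero d
        rw [this]
    | true =>
      right
      intro d
      have := (key d d₀).trans h0
      revert this
      cases f (F d) <;> cases f (F (turn d (-1))) <;> simp
  · intro d
    rw [hF.face, glue_left hF.face, Bool.xor_comm]
  · rintro ⟨v, k⟩
    have hv := hf v
    have key : (f (F (v, 2)) ^^ f (F (v, 1))) = (f (F (v, 0)) ^^ f (F (v, 3))) ∧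
        (f (F (v, 3)) ^^ f (F (v, 2))) = (f (F (v, 1)) ^^ f (F (v, 0))) := by
      revert hv
      cases f (F (v, 0)) <;> cases f (F (v, 1)) <;> cases f (F (v, 2)) <;>
        cases f (F (v, 3)) <;> simp
    rcases ZMod.four_cases k with rfl | rfl | rfl | rfl
    · exact key.1
    · exact key.2
    · exact key.1.symm
    · exact key.2.symm

/-- The black and the white colors of a checkerboard colored diagram can be shifted in opposite
directions. -/
theorem checkerboard_shift {F : Dart D.n → ZMod p} (hF : IsCornerColoring D.glue F)
    (hn : ¬ IsFoxConstant F) {f : ZMod p → Bool} (hf : ∀ d, f (F (turn d (-1))) = !f (F d))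
    (s : ZMod p) : IsCornerColoring D.glue (fun d => F d + if f (F d) then s else -s) ∧
      ¬ IsFoxConstant (fun d => F d + if f (F d) then s else -s) := by
  -- Adjacent regions get opposite shifts, so no Fox color changes.
  have hfox : ∀ d, (F d + if f (F d) then s else -s) +
      (F (turn d (-1)) + if f (F (turn d (-1))) then s else -s) = F d + F (turn d (-1)) := by
    intro d
    rw [hf d]
    cases f (F d) <;> simp <;> ring
  refine ⟨⟨fun d => ?_, fun v => ?_⟩, ?_⟩
  · rw [hF.face]
  · have h1 : f (F (v, 0)) = !f (F (v, 1)) := hf (v, 1)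
    have h3 : f (F (v, 2)) = !f (F (v, 3)) := hf (v, 3)
    rw [h1, h3]
    have := hF.crossing v
    cases f (F (v, 1)) <;> cases f (F (v, 3)) <;> simp <;> linear_combination this
  · rintro ⟨c, hc⟩
    exact hn ⟨c, fun d => (hfox d).symm.trans (hc d)⟩

/-- The colors of a nontrivial coloring with the least number of colors form a parity rigid set. -/
theorem exists_isParityRigid [Fact p.Prime] (hp2 : p ≠ 2) {F : Dart D.n → ZMod p}
    (hF : IsCornerColoring D.glue F) (hn : ¬ IsFoxConstant F) :
    ∃ F' : Dart D.n → ZMod p, IsCornerColoring D.glue F' ∧ ¬ IsFoxConstant F' ∧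
      (Set.range F').ncard ≤ (Set.range F).ncard ∧ IsParityRigid (Set.range F') := by
  induction hk : (Set.range F).ncard using Nat.strong_induction_on generalizing F with
  | _ k ih =>
  by_cases hr : IsParityRigid (Set.range F)
  · exact ⟨F, hF, hn, hk.le, hr⟩
  · rw [IsParityRigid] at hr
    push Not at hr
    obtain ⟨f, hf, _, ⟨a, rfl⟩, _, ⟨b, rfl⟩, hab⟩ := hr
    have hcases := parity_cases hF f fun v => hf _ ⟨_, rfl⟩ _ ⟨_, rfl⟩ _ ⟨_, rfl⟩ _ ⟨_, rfl⟩
      (hF.crossing v)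
    have hcb := hcases.resolve_left fun h => hab (h a b)
    have h2 : (2 : ZMod p) ≠ 0 := by
      have : (2 : ZMod p) = ((2 : ℕ) : ZMod p) := by norm_num
      rw [this, Ne, ZMod.natCast_eq_zero_iff]
      exact fun hd => hp2 ((Nat.prime_dvd_prime_iff_eq Fact.out Nat.prime_two).1 hd)
    -- This shift gives the colors of `a` and `b`, one black and one white, the same new value. As
    -- the new colors are a function of the old ones, their number drops.
    obtain ⟨s, hs⟩ : ∃ s : ZMod p, (F a + if f (F a) then s else -s) =
        F b + if f (F b) then s else -s := by
      cases ha : f (F a) <;> cases hb : f (F b)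
      · exact absurd (ha.trans hb.symm) hab
      · refine ⟨(F a - F b) / 2, ?_⟩
        simp only [Bool.false_eq_true, if_false, if_true]
        field_simp
        ring
      · refine ⟨(F b - F a) / 2, ?_⟩
        simp only [Bool.false_eq_true, if_false, if_true]
        field_simp
        ring
      · exact absurd (ha.trans hb.symm) hab
    obtain ⟨hF', hn'⟩ := checkerboard_shift hF hn hcb s
    have hlt : (Set.range fun d => F d + if f (F d) then s else -s).ncard < k := by
      rw [← hk]
      have hr : (Set.range fun d => F d + if f (F d) then s else -s) =
          (fun x => x + if f x then s else -s) '' Set.range F := by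
        rw [← Set.range_comp]
        rfl
      rw [hr]
      refine lt_of_le_of_ne (Set.ncard_image_le (Set.toFinite _)) fun e => hab ?_
      have hinj := Set.injOn_of_ncard_image_eq e (Set.toFinite _)
      rw [hinj ⟨a, rfl⟩ ⟨b, rfl⟩ hs]
    obtain ⟨F', h1, h3, h4, h5⟩ := ih _ hlt hF' hn' rfl
    exact ⟨F', h1, h3, h4.trans hlt.le, h5⟩

theorem affine_coloring [Fact p.Prime] {F : Dart D.n → ZMod p} (hF : IsCornerColoring D.glue F)
    (hn : ¬ IsFoxConstant F) {u : ZMod p} (hu : u ≠ 0) (v : ZMod p) :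
    IsCornerColoring D.glue (fun d => u * F d + v) ∧ ¬ IsFoxConstant (fun d => u * F d + v) := by
  refine ⟨⟨fun d => ?_, fun w => ?_⟩, ?_⟩
  · rw [hF.face]
  · linear_combination u * hF.crossing w
  · rintro ⟨s, hs⟩
    refine hn ⟨u⁻¹ * (s - 2 * v), fun d => ?_⟩
    have : u * (F d + F (turn d (-1))) = s - 2 * v := by linear_combination hs d
    rw [← this, ← mul_assoc, inv_mul_cancel₀ hu, one_mul]

/-- Few colors suffice only if `θ_p` vanishes on some nontrivial coloring. -/
theorem hasZero_of_ncard_le [Fact p.Prime] (hp : 3 ≤ p) {n : ℕ} (hn : n ≤ 3)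
    {P : List (List ℕ × List (ℕ × ℕ × ℕ))} (hP : ∀ x ∈ P, ∀ r ∈ x.1, r < p)
    (hpot : ∀ x ∈ P, IsPotential p x.1 x.2)
    (h1 : RigidSearch.searchProgression p (P.map Prod.fst) n = true)
    (h2 : RigidSearch.searchNoProgression p (n + 1) = true) {F : Dart D.n → ZMod p}
    (hF : IsCornerColoring D.glue F) (hnt : ¬ IsFoxConstant F)
    (hcard : (Set.range F).ncard ≤ n + 3) : HasZero p D.glue := by
  have hp2 : p ≠ 2 := by omega
  obtain ⟨F', hF', hnt', hle, hr⟩ := exists_isParityRigid hp2 hF hnt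
  -- With a single color all Fox sums would be equal.
  have hntr : (Set.range F').Nontrivial := by
    by_contra h
    rw [Set.not_nontrivial_iff] at h
    refine hnt' ?_
    rcases isEmpty_or_nonempty (Dart D.n) with he | ⟨⟨d₀⟩⟩
    · exact ⟨0, fun d => he.elim d⟩
    · refine ⟨F' d₀ + F' d₀, fun d => ?_⟩
      rw [h ⟨d, rfl⟩ ⟨d₀, rfl⟩, h ⟨turn d (-1), rfl⟩ ⟨d₀, rfl⟩]
  have hRs : ∀ R ∈ P.map Prod.fst, ∀ r ∈ R, r < p := by
    intro R hR
    obtain ⟨x, hx, rfl⟩ := List.mem_map.1 hR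
    exact hP x hx
  -- `θ_p` need not vanish on `F` or `F'`; it does on the affine image of `F'`, another nontrivial
  -- coloring of the diagram, whose colors lie in `R`.
  obtain ⟨R, hR, u, v, hu, huv⟩ := hr.exists_affine hn hp hRs h1 h2 (hle.trans hcard) hntr
  obtain ⟨x, hx, rfl⟩ := List.mem_map.1 hR
  obtain ⟨hG, hGn⟩ := affine_coloring hF' hnt' hu v
  exact ⟨_, hG, hGn, thetaSum_eq_zero_of_isPotential hp2 hG (hpot x hx) fun d => huv _ ⟨d, rfl⟩⟩

end KnotDiagram

/-! ### The maximal parity rigid sets -/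

/-- Representatives of the parity rigid subsets of `ZMod 7` with at most 4 elements, up to affine
maps, with functions whose coboundary is `θ_p` there. -/
def rigidSets7 : List (List ℕ × List (ℕ × ℕ × ℕ)) :=
  [
    ([0, 1, 2, 4], [(0, 1, 6), (0, 2, 2)])]

theorem isPotential_rigidSets7 : ∀ x ∈ rigidSets7, IsPotential 7 x.1 x.2 := by
  decide +kernel

theorem searchProgression_7 :
    RigidSearch.searchProgression 7 (rigidSets7.map Prod.fst) 1 = true := by
  decide +kernel

theorem searchNoProgression_7 : RigidSearch.searchNoProgression 7 2 = true := by
  decide +kernel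

/-- Representatives of the parity rigid subsets of `ZMod 11` with at most 5 elements, up to affine
maps, with functions whose coboundary is `θ_p` there. -/
def rigidSets11 : List (List ℕ × List (ℕ × ℕ × ℕ)) :=
  [
    ([0, 1, 2, 3, 6], [(0, 1, 6), (0, 2, 4), (0, 3, 4), (1, 2, 7), (1, 3, 6)]),
    ([0, 1, 2, 4, 7], [(0, 1, 1), (0, 2, 3), (1, 4, 2)])]

theorem isPotential_rigidSets11 : ∀ x ∈ rigidSets11, IsPotential 11 x.1 x.2 := by
  decide +kernel

theorem searchProgression_11 :
    RigidSearch.searchProgression 11 (rigidSets11.map Prod.fst) 2 = true := by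
  decide +kernel

theorem searchNoProgression_11 : RigidSearch.searchNoProgression 11 3 = true := by
  decide +kernel

/-- Representatives of the parity rigid subsets of `ZMod 13` with at most 5 elements, up to affine
maps, with functions whose coboundary is `θ_p` there. -/
def rigidSets13 : List (List ℕ × List (ℕ × ℕ × ℕ)) :=
  [
    ([0, 1, 2, 4, 7], [(0, 1, 3), (0, 2, 2), (0, 4, 11), (1, 4, 9)])]

theorem isPotential_rigidSets13 : ∀ x ∈ rigidSets13, IsPotential 13 x.1 x.2 := by
  decide +kernel

theorem searchProgression_13 :
    RigidSearch.searchProgression 13 (rigidSets13.map Prod.fst) 2 = true := by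
  decide +kernel

theorem searchNoProgression_13 : RigidSearch.searchNoProgression 13 3 = true := by
  decide +kernel

/-- Representatives of the parity rigid subsets of `ZMod 19` with at most 6 elements, up to affine
maps, with functions whose coboundary is `θ_p` there. -/
def rigidSets19 : List (List ℕ × List (ℕ × ℕ × ℕ)) :=
  [
    ([0, 1, 2, 3, 5, 10], [(0, 1, 1), (0, 2, 10), (0, 3, 8), (0, 5, 14), (1, 2, 5), (1, 3, 7), (1,
      5, 18), (2, 3, 12)]),
    ([0, 1, 2, 3, 6, 10], [(0, 1, 1), (0, 2, 15), (0, 3, 1), (0, 6, 18), (1, 2, 10), (2, 6, 13)]),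
    ([0, 1, 2, 3, 6, 11], [(0, 1, 11), (0, 2, 4), (0, 3, 9), (0, 6, 7), (1, 2, 8), (1, 3, 17), (1,
      6, 9)]),
    ([0, 1, 2, 3, 6, 12], [(0, 1, 10), (0, 2, 3), (0, 3, 10), (0, 6, 8), (1, 2, 8), (2, 3, 2)]),
    ([0, 1, 2, 3, 6, 13], [(0, 1, 2), (0, 2, 16), (0, 3, 2), (1, 2, 10), (1, 6, 10)]),
    ([0, 1, 2, 3, 6, 14], [(0, 1, 16), (0, 2, 13), (0, 3, 18), (0, 6, 12), (1, 2, 12), (1, 3, 2),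
      (3, 6, 15)]),
    ([0, 1, 2, 3, 7, 12], [(0, 2, 12), (1, 2, 8), (2, 3, 2), (2, 7, 17)]),
    ([0, 1, 2, 4, 5, 10], [(0, 1, 1), (0, 2, 10), (0, 4, 8), (0, 5, 14), (1, 2, 5), (1, 4, 18), (1,
      5, 18), (2, 4, 1)]),
    ([0, 1, 2, 4, 5, 14], [(0, 1, 5), (0, 2, 15), (0, 4, 5), (1, 2, 6), (1, 4, 11), (2, 4, 12), (4,
      5, 8)]),
    ([0, 1, 2, 4, 7, 11], [(0, 1, 18), (0, 2, 11), (0, 4, 8), (0, 7, 17), (1, 2, 8), (1, 4, 15)]),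
    ([0, 1, 2, 4, 7, 12], [(0, 1, 18), (0, 2, 3), (1, 4, 14), (1, 7, 18), (2, 7, 17)]),
    ([0, 1, 2, 4, 7, 15], [(0, 1, 11), (0, 2, 3), (1, 2, 7), (1, 4, 4), (1, 7, 12), (4, 7, 4)])]

theorem isPotential_rigidSets19 : ∀ x ∈ rigidSets19, IsPotential 19 x.1 x.2 := by
  decide +kernel

theorem searchProgression_19 :
    RigidSearch.searchProgression 19 (rigidSets19.map Prod.fst) 3 = true := by
  decide +kernel

theorem searchNoProgression_19 : RigidSearch.searchNoProgression 19 4 = true := by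
  decide +kernel

/-- Representatives of the parity rigid subsets of `ZMod 23` with at most 6 elements, up to affine
maps, with functions whose coboundary is `θ_p` there. -/
def rigidSets23 : List (List ℕ × List (ℕ × ℕ × ℕ)) :=
  [
    ([0, 1, 2, 3, 6, 12], [(0, 1, 13), (0, 2, 21), (0, 3, 6), (0, 6, 14), (1, 2, 2), (1, 3, 12)]),
    ([0, 1, 2, 4, 7, 12], [(0, 1, 13), (0, 2, 19), (0, 4, 20), (1, 4, 6), (2, 7, 18)]),
    ([0, 1, 2, 4, 7, 13], [(0, 1, 22), (0, 2, 22), (1, 2, 17), (1, 4, 5), (1, 7, 22)]),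
    ([0, 1, 2, 4, 7, 14], [(0, 1, 16), (0, 2, 22), (0, 7, 5), (1, 4, 3), (1, 7, 20)]),
    ([0, 1, 2, 4, 7, 17], [(0, 1, 18), (0, 2, 1), (0, 4, 2), (0, 7, 12), (1, 4, 2), (4, 7, 4)]),
    ([0, 1, 2, 4, 9, 14], [(0, 1, 16), (0, 2, 22), (1, 4, 3), (4, 9, 22)]),
    ([0, 1, 2, 4, 10, 19], [(0, 1, 7), (0, 2, 13), (1, 10, 17), (2, 4, 9), (2, 10, 10)])]

theorem isPotential_rigidSets23 : ∀ x ∈ rigidSets23, IsPotential 23 x.1 x.2 := by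
  decide +kernel

theorem searchProgression_23 :
    RigidSearch.searchProgression 23 (rigidSets23.map Prod.fst) 3 = true := by
  decide +kernel

theorem searchNoProgression_23 : RigidSearch.searchNoProgression 23 4 = true := by
  decide +kernel

/-- Representatives of the parity rigid subsets of `ZMod 29` with at most 6 elements, up to affine
maps, with functions whose coboundary is `θ_p` there. -/
def rigidSets29 : List (List ℕ × List (ℕ × ℕ × ℕ)) :=
  [
    ([0, 1, 2, 4, 8, 15], [(0, 1, 3), (0, 2, 15), (0, 4, 5), (0, 8, 23), (1, 8, 4)])]

theorem isPotential_rigidSets29 : ∀ x ∈ rigidSets29, IsPotential 29 x.1 x.2 := by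
  decide +kernel

theorem searchProgression_29 :
    RigidSearch.searchProgression 29 (rigidSets29.map Prod.fst) 3 = true := by
  decide +kernel

theorem searchNoProgression_29 : RigidSearch.searchNoProgression 29 4 = true := by
  decide +kernel

/-- Representatives of the parity rigid subsets of `ZMod 31` with at most 6 elements, up to affine
maps, with functions whose coboundary is `θ_p` there. -/
def rigidSets31 : List (List ℕ × List (ℕ × ℕ × ℕ)) :=
  [
    ([0, 1, 2, 4, 8, 16], [(0, 1, 30), (0, 2, 26), (0, 4, 10), (0, 8, 8)])]

theorem isPotential_rigidSets31 : ∀ x ∈ rigidSets31, IsPotential 31 x.1 x.2 := by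
  decide +kernel

theorem searchProgression_31 :
    RigidSearch.searchProgression 31 (rigidSets31.map Prod.fst) 3 = true := by
  decide +kernel

theorem searchNoProgression_31 : RigidSearch.searchNoProgression 31 4 = true := by
  decide +kernel

/-- If a coloring has at most `⌊log₂ p⌋ + 2` colors, then `θ_p` vanishes on some nontrivial
coloring of the same diagram. -/
theorem KnotDiagram.hasZero_of_ncard_le_log {D : KnotDiagram} {p : ℕ} [Fact p.Prime] (hp5 : 5 < p)
    (hp32 : p < 2 ^ 5) (hp17 : p ≠ 17) {F : Dart D.n → ZMod p} (hF : IsCornerColoring D.glue F)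
    (hnt : ¬ IsFoxConstant F) (hcard : (Set.range F).ncard ≤ Nat.log 2 p + 2) :
    HasZero p D.glue := by
  have hprime : p.Prime := Fact.out
  have hcases : p = 7 ∨ p = 11 ∨ p = 13 ∨ p = 19 ∨ p = 23 ∨ p = 29 ∨ p = 31 := by
    clear hcard hnt hF F
    interval_cases p <;> first | omega | (exfalso; revert hprime; norm_num)
  rcases hcases with rfl | rfl | rfl | rfl | rfl | rfl | rfl
  · have hlog : Nat.log 2 7 = 2 := Nat.log_eq_of_pow_le_of_lt_pow (by norm_num) (by norm_num)
    rw [hlog] at hcard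
    -- Here and in the other cases `n = ⌊log₂ p⌋ - 1`, so that `n + 3` is the allowed number of
    -- colors.
    exact hasZero_of_ncard_le (n := 1) (by norm_num) (by norm_num) (by decide)
      isPotential_rigidSets7 searchProgression_7 searchNoProgression_7 hF hnt hcard
  · have hlog : Nat.log 2 11 = 3 := Nat.log_eq_of_pow_le_of_lt_pow (by norm_num) (by norm_num)
    rw [hlog] at hcard
    exact hasZero_of_ncard_le (n := 2) (by norm_num) (by norm_num) (by decide)
      isPotential_rigidSets11 searchProgression_11 searchNoProgression_11 hF hnt hcard
  · have hlog : Nat.log 2 13 = 3 := Nat.log_eq_of_pow_le_of_lt_pow (by norm_num) (by norm_num)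
    rw [hlog] at hcard
    exact hasZero_of_ncard_le (n := 2) (by norm_num) (by norm_num) (by decide)
      isPotential_rigidSets13 searchProgression_13 searchNoProgression_13 hF hnt hcard
  · have hlog : Nat.log 2 19 = 4 := Nat.log_eq_of_pow_le_of_lt_pow (by norm_num) (by norm_num)
    rw [hlog] at hcard
    exact hasZero_of_ncard_le (n := 3) (by norm_num) (by norm_num) (by decide)
      isPotential_rigidSets19 searchProgression_19 searchNoProgression_19 hF hnt hcard
  · have hlog : Nat.log 2 23 = 4 := Nat.log_eq_of_pow_le_of_lt_pow (by norm_num) (by norm_num)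
    rw [hlog] at hcard
    exact hasZero_of_ncard_le (n := 3) (by norm_num) (by norm_num) (by decide)
      isPotential_rigidSets23 searchProgression_23 searchNoProgression_23 hF hnt hcard
  · have hlog : Nat.log 2 29 = 4 := Nat.log_eq_of_pow_le_of_lt_pow (by norm_num) (by norm_num)
    rw [hlog] at hcard
    exact hasZero_of_ncard_le (n := 3) (by norm_num) (by norm_num) (by decide)
      isPotential_rigidSets29 searchProgression_29 searchNoProgression_29 hF hnt hcard
  · have hlog : Nat.log 2 31 = 4 := Nat.log_eq_of_pow_le_of_lt_pow (by norm_num) (by norm_num)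
    rw [hlog] at hcard
    exact hasZero_of_ncard_le (n := 3) (by norm_num) (by norm_num) (by decide)
      isPotential_rigidSets31 searchProgression_31 searchNoProgression_31 hF hnt hcard

theorem theorem5p2 (p : ℕ) [Fact p.Prime] (hp5 : 5 < p) (hp32 : p < 2 ^ 5) (hp17 : p ≠ 17)
    (K : Knot) (hK : K.IsDehnColorable p)
    (D : KnotDiagram) (hD : K.HasDiagram D) (h0 : (0 : ZMod p) ∉ D.PhiNT (theta p)) :
    Nat.log 2 p + 3 ≤ K.mincol p := by
  by_contra hlt
  have hne : {m | ∃ D : KnotDiagram, K.HasDiagram D ∧ ∃ C ∈ D.ColNT p,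
      m = (Set.range C).ncard}.Nonempty := by
    obtain ⟨D', hD', C, hC⟩ := hK
    exact ⟨_, D', hD', C, hC, rfl⟩
  -- Colorability makes the set nonempty, so the infimum is attained and is not the default value
  -- `0`.
  obtain ⟨D', hD', C, ⟨hC, hCn⟩, hm⟩ := Nat.sInf_mem hne
  have hcard : (Set.range fun d => C (D'.regionOf d)).ncard ≤ Nat.log 2 p + 2 := by
    have hr : (Set.range fun d => C (D'.regionOf d)) = Set.range C :=
      (Quotient.mk_surjective : Function.Surjective D'.regionOf).range_comp C
    rw [hr, ← hm]
    have : K.mincol p < Nat.log 2 p + 3 := not_le.1 hlt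
    exact Nat.le_of_lt_succ this
  -- The hypothesis about `D` moves to the diagram `D'` that realizes the minimum.
  rw [KnotDiagram.zero_mem_PhiNT_iff, hD.hasZero_iff hD'] at h0
  exact h0 (KnotDiagram.hasZero_of_ncard_le_log hp5 hp32 hp17
    ((KnotDiagram.isDehnColoring_iff C).1 hC)
    (fun h => hCn ((KnotDiagram.isTrivialColoring_iff hC).2 h)) hcard)
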